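/- Let $n\ge 1$. For a Borel probability measure $\mu$ on $\mathbb R^n$ put $\Lambda_\mu(\xi)=\log\int e^{\langle x,\xi\rangle}\,d\mu(x)\in(-\infty,\infty]$ and let $\Lambda_\mu^\ast(x)=\sup_{\xi\in\mathbb R^n}\big(\langle x,\xi\rangle-\Lambda_\mu(\xi)\big)\in[0,\infty]$ be its Cramér transform; for a random vector $X$ with law $\mu$ write $\Lambda_X^\ast=\Lambda_\mu^\ast$, and let $e^{-\infty}=0$. The measure $\mu$ is log-concave if $\mu((1-t)A+tB)\ge\mu(A)^{1-t}\mu(B)^t$ for all Borel sets $A,B\subset\mathbb R^n$ and all $t\in(0,1)$. Let $\mathcal E$ be the isotropic random vector in $\mathbb R^n$ with density $c_n e^{-\sqrt{n+1}\,|x|}$, where $c_n=\frac{(n+1)^{n/2}}{n\,\omega_n\,\Gamma(n)}$ and $\omega_n$ is the volume of the Euclidean unit ball. Let $X$ be a random vector in $\mathbb R^n$ whose law is log-concave, invariant under all orthogonal transformations of $\mathbb R^n$, and not concentrated on a hyperplane (that is, $\mathbb P(X\in H)<1$ for every affine hyperplane $H$; here this only excludes $X=0$ almost surely). Then $$\mathbb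 E\, e^{-\Lambda_X^\ast(X)}\le \mathbb E\, e^{-\Lambda_{\mathcal E}^\ast(\mathcal E)} .$$ -/

import Mathlib

open MeasureTheory
open scoped ENNReal Pointwise RealInnerProductSpace

noncomputable section

/-- A Borel measure `μ` on `ℝⁿ` is log-concave if
`μ((1-t)A + tB) ≥ μ(A)^(1-t) μ(B)^t` for all Borel `A, B` and `t ∈ (0,1)`. -/
def IsLogConcave {n : ℕ} (μ : Measure (EuclideanSpace ℝ (Fin n))) : Prop :=
  ∀ A B : Set (EuclideanSpace ℝ (Fin n)), MeasurableSet A → MeasurableSet B →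
    ∀ t : ℝ, 0 < t → t < 1 → μ A ^ (1 - t) * μ B ^ t ≤ μ ((1 - t) • A + t • B)

/-- The measure `μ` is not concentrated on a hyperplane: `μ(H) < 1` for every affine
hyperplane `H`. -/
def IsNondegenerate {n : ℕ} (μ : Measure (EuclideanSpace ℝ (Fin n))) : Prop :=
  ∀ (θ : EuclideanSpace ℝ (Fin n)) (s : ℝ), θ ≠ 0 → μ {x | ⟪x, θ⟫ = s} < 1

/-- The measure `μ` is invariant under the orthogonal group. -/
def IsRotationallyInvariant {n : ℕ} (μ : Measure (EuclideanSpace ℝ (Fin n))) : Prop :=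
  ∀ U : EuclideanSpace ℝ (Fin n) ≃ₗᵢ[ℝ] EuclideanSpace ℝ (Fin n), μ.map U = μ

/-- The logarithmic Laplace transform `Λ_μ(ξ) = log ∫ e^⟨x,ξ⟩ dμ(x)`, with values in `[-∞, ∞]`. -/
def logLaplace {n : ℕ} (μ : Measure (EuclideanSpace ℝ (Fin n)))
    (ξ : EuclideanSpace ℝ (Fin n)) : EReal :=
  ENNReal.log (∫⁻ x, ENNReal.ofReal (Real.exp ⟪x, ξ⟫) ∂μ)

/-- The Cramér transform `Λ*_μ(x) = sup_ξ (⟨x,ξ⟩ - Λ_μ(ξ))`, with values in `[-∞, ∞]`. -/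
def cramer {n : ℕ} (μ : Measure (EuclideanSpace ℝ (Fin n)))
    (x : EuclideanSpace ℝ (Fin n)) : EReal :=
  ⨆ ξ : EuclideanSpace ℝ (Fin n), ((⟪x, ξ⟫ : ℝ) : EReal) - logLaplace μ ξ

/-- The normalising constant `c_n = (n+1)^(n/2) / (n ω_n Γ(n))`, where `ω_n` is the volume of the
Euclidean unit ball of `ℝⁿ`. -/
def radialExpConst (n : ℕ) : ℝ :=
  ((n : ℝ) + 1) ^ ((n : ℝ) / 2) /
    (n * (volume (Metric.ball (0 : EuclideanSpace ℝ (Fin n)) 1)).toReal * Real.Gamma n)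

/-- The law of the isotropic radial exponential vector on `ℝⁿ` (for `n ≥ 1`), with Lebesgue density
`c_n e^{-√(n+1) |x|}`. -/
def radialExp (n : ℕ) : Measure (EuclideanSpace ℝ (Fin n)) :=
  volume.withDensity fun x =>
    ENNReal.ofReal (radialExpConst n * Real.exp (-(Real.sqrt ((n : ℝ) + 1) * ‖x‖)))

end

/-! ### Exponential integrals and the volume of an ellipsoid with a focus at the origin -/

section ExponentialIntegral

variable {E : Type*} [NormedAddCommGroup E] [InnerProductSpace ℝ E] [FiniteDimensional ℝ E]
  [MeasurableSpace E] [BorelSpace E]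

/-! Let `μ` be the law of `X` and let `ν` be the law with density proportional to `e^{-a|x|}`, where
`a` is chosen so that `μ` and `ν` have the same second moment. The engine is a domination principle,
`lintegral_convex_le_of_isLogConcave`: `∫ φ(|x|²) dμ ≤ ∫ φ(|x|²) dν` for every nonnegative,
continuous convex `φ`. It is used twice.

First, the Laplace transform of a rotationally invariant law is the integral of a spherical average
of `cosh`, which is convex in `|x|²` because its power series in `|x|²` has nonnegative
coefficients. Hence `Λ_μ ≤ Λ_ν`, so `e^{-Λ*_μ} ≤ e^{-Λ*_ν}` pointwise. Second, `e^{-Λ*_ν}` is itself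
convex in `|x|²`: the explicit formula `Λ_ν(ξ) = -((n+1)/2) log(1 - |ξ|²)` (for `a = 1`, `|ξ| < 1`)
exhibits it as a supremum of exponentials of affine functions of `|x|²`. So its `μ`-integral is at
most its `ν`-integral, and the latter does not depend on `a`.

The domination principle is a crossing argument. Along a ray the log-density of `ν` is affine and
that of `μ` is concave, so the density of `μ` is the larger one on an interval of radii. Mass and
second moment agree, so an affine function of `|x|²` may be subtracted from `φ` for free; the chord
of `φ` at the two crossing radii makes the remaining integrand nonnegative. A law without a density
is first convolved with a small ball and rescaled, and Fatou's lemma removes the smoothing. -/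

theorem lintegral_Ioi_ofReal_exp_neg (c : ℝ) :
    ∫⁻ t in Set.Ioi c, ENNReal.ofReal (Real.exp (-t)) = ENNReal.ofReal (Real.exp (-c)) := by
  rw [← ofReal_integral_eq_lintegral_ofReal (integrableOn_exp_neg_Ioi c)
    (Filter.Eventually.of_forall fun t => (Real.exp_pos _).le), integral_exp_neg_Ioi]

theorem lintegral_Ioi_pow_mul_exp_neg (k : ℕ) :
    ∫⁻ t in Set.Ioi (0 : ℝ), ENNReal.ofReal (Real.exp (-t)) * ENNReal.ofReal (t ^ k) =
      ENNReal.ofReal k.factorial := by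
  have hk : (0 : ℝ) < (k : ℝ) + 1 := by positivity
  have h := Real.GammaIntegral_convergent hk
  rw [← Real.Gamma_nat_eq_factorial, Real.Gamma_eq_integral hk,
    ofReal_integral_eq_lintegral_ofReal h]
  · refine setLIntegral_congr_fun measurableSet_Ioi fun t ht => ?_
    rw [← ENNReal.ofReal_mul (Real.exp_pos _).le, add_sub_cancel_right, Real.rpow_natCast]
  · filter_upwards [ae_restrict_mem measurableSet_Ioi] with t ht
    have : (0 : ℝ) < t := ht
    positivity

/-- The integral of `e^{-p}` for a nonnegative positively homogeneous function `p`. -/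
theorem lintegral_exp_neg_of_homogeneous {p : E → ℝ} (hp : Measurable p) (hp0 : ∀ x, 0 ≤ p x)
    (hph : ∀ (r : ℝ) (x : E), 0 < r → p (r • x) = r * p x) :
    ∫⁻ x, ENNReal.ofReal (Real.exp (-p x)) =
      ENNReal.ofReal (Module.finrank ℝ E).factorial * volume {x | p x < 1} := by
  have hlevel : ∀ t : ℝ, 0 < t →
      volume {x | p x < t} = ENNReal.ofReal (t ^ Module.finrank ℝ E) * volume {x | p x < 1} := by
    intro t ht
    have : {x | p x < t} = t • {x | p x < 1} := by
      ext x
      rw [Set.mem_smul_set_iff_inv_smul_mem₀ ht.ne', Set.mem_ofPred_eq, Set.mem_ofPred_eq,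
        hph _ _ (inv_pos.2 ht), inv_mul_lt_iff₀ ht, mul_one]
    rw [this, Measure.addHaar_smul, abs_of_nonneg (by positivity)]
  have hmeas : MeasurableSet {q : E × ℝ | p q.1 < q.2} :=
    measurableSet_lt (hp.comp measurable_fst) measurable_snd
  have hmeas' : Measurable fun q : E × ℝ =>
      {q : E × ℝ | p q.1 < q.2}.indicator (fun q => ENNReal.ofReal (Real.exp (-q.2))) q := by
    refine Measurable.indicator ?_ hmeas
    fun_prop
  -- Layer cake: `e^{-p(x)}` is the integral of `e^{-t}` over `t > p(x)`, and by homogeneity each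
  -- sublevel set is a dilate of `{p < 1}`.
  calc ∫⁻ x, ENNReal.ofReal (Real.exp (-p x))
      = ∫⁻ x, ∫⁻ t in Set.Ioi (0 : ℝ),
          {q : E × ℝ | p q.1 < q.2}.indicator (fun q => ENNReal.ofReal (Real.exp (-q.2))) (x, t) := by
        refine lintegral_congr fun x => ?_
        rw [← lintegral_Ioi_ofReal_exp_neg, ← lintegral_indicator measurableSet_Ioi,
          ← lintegral_indicator measurableSet_Ioi]
        refine lintegral_congr fun t => ?_
        by_cases h : p x < t
        · have h0 : 0 < t := (hp0 x).trans_lt h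
          simp [h, h0]
        · simp [Set.indicator, h]
    _ = ∫⁻ t in Set.Ioi (0 : ℝ), ∫⁻ x,
          {q : E × ℝ | p q.1 < q.2}.indicator (fun q => ENNReal.ofReal (Real.exp (-q.2))) (x, t) :=
        lintegral_lintegral_swap hmeas'.aemeasurable
    _ = ∫⁻ t in Set.Ioi (0 : ℝ), ENNReal.ofReal (Real.exp (-t)) *
          ENNReal.ofReal (t ^ Module.finrank ℝ E) * volume {x | p x < 1} := by
        refine setLIntegral_congr_fun measurableSet_Ioi fun t ht => ?_
        have h1 : (fun x => {q : E × ℝ | p q.1 < q.2}.indicator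
            (fun q => ENNReal.ofReal (Real.exp (-q.2))) (x, t)) =
            {x | p x < t}.indicator fun _ => ENNReal.ofReal (Real.exp (-t)) := by
          ext x
          simp [Set.indicator]
        rw [h1, lintegral_indicator_const (measurableSet_lt hp measurable_const), hlevel t ht,
          mul_assoc]
    _ = _ := by
        rw [lintegral_mul_const _ (by fun_prop), lintegral_Ioi_pow_mul_exp_neg]

/-- The ellipsoid `|x| < 1 + ⟨x, ξ⟩` with a focus at the origin has volume
`(1 - |ξ|²)^{-(n+1)/2}` times that of the unit ball. -/
theorem volume_norm_sub_inner_lt_one {ξ : E} (hξ : ‖ξ‖ < 1) :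
    volume {x : E | ‖x‖ - ⟪x, ξ⟫ < 1} =
      ENNReal.ofReal (((√(1 - ‖ξ‖ ^ 2)) ^ (Module.finrank ℝ E + 1))⁻¹) *
        volume (Metric.ball (0 : E) 1) := by
  set s := ‖ξ‖ with hs
  have hs0 : 0 ≤ s := norm_nonneg _
  have hw0 : 0 < 1 - s ^ 2 := by nlinarith
  set q := √(1 - s ^ 2) with hq
  have hq0 : 0 < q := Real.sqrt_pos.2 hw0
  have hq2 : q ^ 2 = 1 - s ^ 2 := Real.sq_sqrt hw0.le
  -- With this `c`, the map `y ↦ y - c⟨y, ξ⟩ξ` has eigenvalue `1 - c s² = q` along `ξ`, so it is the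
  -- square root of `I - ξξᵀ`.
  set c := (1 + q)⁻¹ with hc
  have hcq : c * (1 + q) = 1 := inv_mul_cancel₀ (by positivity)
  have hcs : c * s ^ 2 = 1 - q := by
    have : s ^ 2 = (1 + q) * (1 - q) := by nlinarith
    rw [this, ← mul_assoc, hcq, one_mul]
  have hcc : 2 * c - c ^ 2 * s ^ 2 = 1 := by
    have : c ^ 2 * s ^ 2 = c * (1 - q) := by rw [← hcs]; ring
    rw [this]; linarith
  let f : Module.Dual ℝ E := (innerₛₗ ℝ ξ)
  let A : E →ₗ[ℝ] E := q • LinearMap.transvection f ((-c) • ξ)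
  have hA : ∀ y, A y = q • (y - (c * ⟪y, ξ⟫) • ξ) := by
    intro y
    simp only [A, f, LinearMap.smul_apply, LinearMap.transvection.apply, innerₛₗ_apply_apply,
      real_inner_comm, smul_smul]
    congr 1
    rw [sub_eq_add_neg, ← neg_smul]
    congr 2
    ring
  have hdet : LinearMap.det A = q ^ (Module.finrank ℝ E + 1) := by
    have h1 : 1 + f ((-c) • ξ) = q := by
      simp only [f, innerₛₗ_apply_apply, inner_smul_right, real_inner_self_eq_norm_sq, ← hs]
      linarith
    rw [LinearMap.det_smul, LinearMap.transvection.det, h1, pow_succ]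
  have hAn : ∀ y, ‖A y‖ ^ 2 = (1 - s ^ 2) * (‖y‖ ^ 2 - ⟪y, ξ⟫ ^ 2) := by
    intro y
    rw [hA, norm_smul, mul_pow, Real.norm_eq_abs, sq_abs, hq2, norm_sub_sq_real, norm_smul,
      inner_smul_right, Real.norm_eq_abs, mul_pow, sq_abs, ← hs]
    have : (c * ⟪y, ξ⟫) ^ 2 * s ^ 2 = (2 * c - 1) * ⟪y, ξ⟫ ^ 2 := by
      have : c ^ 2 * s ^ 2 = 2 * c - 1 := by linarith
      rw [← this]; ring
    rw [this]; ring
  -- Squaring `|x| < 1 + ⟨x, ξ⟩` and completing the square gives an ellipsoid centred at `ξ / (1 -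
  -- |ξ|²)`. Squaring loses nothing because `1 + ⟨x, ξ⟩ + |x| > 0`.
  have hset : {x : E | ‖x‖ - ⟪x, ξ⟫ < 1} =
      (fun x => x + -((1 - s ^ 2)⁻¹ • ξ)) ⁻¹' (A ⁻¹' Metric.ball 0 1) := by
    ext x
    simp only [Set.mem_ofPred_eq, Set.mem_preimage, mem_ball_zero_iff]
    have h1 : ‖A (x + -((1 - s ^ 2)⁻¹ • ξ))‖ ^ 2 - 1 =
        (1 - s ^ 2) * (‖x‖ ^ 2 - (1 + ⟪x, ξ⟫) ^ 2) := by
      rw [hAn, ← sub_eq_add_neg, norm_sub_sq_real, inner_sub_left, inner_smul_left,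
        inner_smul_right, norm_smul, mul_pow, real_inner_self_eq_norm_sq, ← hs]
      simp only [Real.norm_eq_abs, sq_abs, conj_trivial]
      field_simp
      ring
    have hCS := abs_le.1 (abs_real_inner_le_norm x ξ)
    rw [← hs] at hCS
    have hx0 := norm_nonneg x
    have hpos : 0 < 1 + ⟪x, ξ⟫ + ‖x‖ := by nlinarith
    have h2 : ‖A (x + -((1 - s ^ 2)⁻¹ • ξ))‖ < 1 ↔
        ‖A (x + -((1 - s ^ 2)⁻¹ • ξ))‖ ^ 2 < 1 := by
      rw [sq_lt_one_iff₀ (norm_nonneg _)]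
    have h3 : ‖x‖ ^ 2 - (1 + ⟪x, ξ⟫) ^ 2 = (1 + ⟪x, ξ⟫ + ‖x‖) * (‖x‖ - ⟪x, ξ⟫ - 1) := by ring
    rw [h2, ← sub_neg, ← sub_neg (a := ‖A (x + -((1 - s ^ 2)⁻¹ • ξ))‖ ^ 2), h1, h3,
      ← smul_eq_mul, smul_neg_iff_of_pos_left hw0, ← smul_eq_mul, smul_neg_iff_of_pos_left hpos]
  rw [hset, measure_preimage_add_right, Measure.addHaar_preimage_linearMap, hdet,
    abs_of_pos (by positivity)]
  rw [hdet]; positivity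

/-- The exponential integral `∫ e^{⟨x, ξ⟩ - |x|} dx` for `|ξ| < 1`. -/
theorem lintegral_exp_inner_sub_norm {ξ : E} (hξ : ‖ξ‖ < 1) :
    ∫⁻ x : E, ENNReal.ofReal (Real.exp (⟪x, ξ⟫ - ‖x‖)) =
      ENNReal.ofReal (Module.finrank ℝ E).factorial *
        (ENNReal.ofReal (((√(1 - ‖ξ‖ ^ 2)) ^ (Module.finrank ℝ E + 1))⁻¹) *
        volume (Metric.ball (0 : E) 1)) := by
  rw [← volume_norm_sub_inner_lt_one hξ, ← lintegral_exp_neg_of_homogeneous]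
  · simp
  · fun_prop
  · intro x
    have := real_inner_le_norm x ξ
    nlinarith [norm_nonneg x]
  · intro r x hr
    rw [norm_smul, inner_smul_left, Real.norm_of_nonneg hr.le]
    simp
    ring

end ExponentialIntegral

/-! ### Cramér transforms and the radial exponential laws -/

section Cramer

variable {n : ℕ}

/-- The Laplace transform `ξ ↦ ∫ e^⟨x,ξ⟩ dμ(x)`. -/
noncomputable def laplace (μ : Measure (EuclideanSpace ℝ (Fin n)))
    (ξ : EuclideanSpace ℝ (Fin n)) : ℝ≥0∞ :=
  ∫⁻ x, ENNReal.ofReal (Real.exp ⟪x, ξ⟫) ∂μ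

/-- `exp` is an order isomorphism from `EReal` to `ℝ≥0∞`, so the supremum becomes an infimum of
products. All later work takes place in this form, where infinite Laplace transforms need no special
care. -/
theorem exp_neg_cramer (μ : Measure (EuclideanSpace ℝ (Fin n))) (x : EuclideanSpace ℝ (Fin n)) :
    EReal.exp (-cramer μ x) = ⨅ ξ, ENNReal.ofReal (Real.exp (-⟪x, ξ⟫)) * laplace μ ξ := by
  have h1 : ∀ f : EuclideanSpace ℝ (Fin n) → EReal, EReal.exp (-⨆ ξ, f ξ) =
      ⨅ ξ, EReal.exp (-f ξ) := by
    intro f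
    rw [EReal.exp_neg]
    have : EReal.exp (⨆ ξ, f ξ) = ⨆ ξ, EReal.exp (f ξ) := EReal.expOrderIso.map_iSup f
    rw [this, ENNReal.inv_iSup]
    simp_rw [EReal.exp_neg]
  rw [cramer, h1]
  refine iInf_congr fun ξ => ?_
  rw [EReal.neg_sub (.inl (EReal.coe_ne_bot _)) (.inl (EReal.coe_ne_top _)), EReal.exp_add,
    logLaplace, ENNReal.exp_log, ← EReal.coe_neg, EReal.exp_coe, laplace]

theorem exp_neg_cramer_mono {μ ν : Measure (EuclideanSpace ℝ (Fin n))}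
    (h : ∀ ξ, laplace μ ξ ≤ laplace ν ξ) (x : EuclideanSpace ℝ (Fin n)) :
    EReal.exp (-cramer μ x) ≤ EReal.exp (-cramer ν x) := by
  rw [exp_neg_cramer, exp_neg_cramer]
  exact iInf_mono fun ξ => mul_le_mul_right (h ξ) _

/-- The normalising constant of the density `e^{-a|x|}` on `ℝⁿ`. -/
noncomputable def expConst (n : ℕ) (a : ℝ) : ℝ :=
  a ^ n / (n.factorial * (volume (Metric.ball (0 : EuclideanSpace ℝ (Fin n)) 1)).toReal)

/-- The probability measure on `ℝⁿ` with density proportional to `e^{-a|x|}`. -/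
noncomputable def expMeasure (n : ℕ) (a : ℝ) : Measure (EuclideanSpace ℝ (Fin n)) :=
  volume.withDensity fun x => ENNReal.ofReal (expConst n a * Real.exp (-(a * ‖x‖)))

theorem volume_unit_ball_toReal_pos (n : ℕ) :
    0 < (volume (Metric.ball (0 : EuclideanSpace ℝ (Fin n)) 1)).toReal :=
  ENNReal.toReal_pos (Metric.measure_ball_pos _ _ one_pos).ne' measure_ball_lt_top.ne

theorem expConst_pos (n : ℕ) {a : ℝ} (ha : 0 < a) : 0 < expConst n a := by
  have := volume_unit_ball_toReal_pos n
  unfold expConst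
  positivity

theorem radialExp_eq_expMeasure (hn : 1 ≤ n) : radialExp n = expMeasure n √((n : ℝ) + 1) := by
  have h : radialExpConst n = expConst n √((n : ℝ) + 1) := by
    unfold radialExpConst expConst
    obtain ⟨m, rfl⟩ : ∃ m, n = m + 1 := ⟨n - 1, by omega⟩
    have h1 : ((m + 1 : ℕ) : ℝ) * Real.Gamma (m + 1 : ℕ) = (m + 1).factorial := by
      rw [Nat.cast_add_one, Real.Gamma_nat_eq_factorial, Nat.factorial_succ]
      push_cast
      ring
    have h2 : (((m + 1 : ℕ) : ℝ) + 1) ^ (((m + 1 : ℕ) : ℝ) / 2) =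
        √(((m + 1 : ℕ) : ℝ) + 1) ^ (m + 1) := by
      rw [Real.sqrt_eq_rpow, ← Real.rpow_natCast, ← Real.rpow_mul (by positivity)]
      congr 1
      ring
    rw [h2, ← h1]
    ring
  rw [radialExp, expMeasure, h]

/-- No measurability of `g` is needed since the density is finite; this lets the formula apply
directly to `e^{-Λ*}`. -/
theorem lintegral_expMeasure (a : ℝ) {g : EuclideanSpace ℝ (Fin n) → ℝ≥0∞} :
    ∫⁻ x, g x ∂(expMeasure n a) =
      ∫⁻ x, ENNReal.ofReal (expConst n a * Real.exp (-(a * ‖x‖))) * g x :=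
  lintegral_withDensity_eq_lintegral_mul_non_measurable _ (by fun_prop)
    (Filter.Eventually.of_forall fun _ => ENNReal.ofReal_lt_top) _

theorem lintegral_comp_smul (h : EuclideanSpace ℝ (Fin n) → ℝ≥0∞) {r : ℝ} (hr : 0 < r) :
    ∫⁻ x, h (r • x) = ENNReal.ofReal ((r ^ n)⁻¹) * ∫⁻ x, h x := by
  have h1 := lintegral_map_equiv (μ := (volume : Measure (EuclideanSpace ℝ (Fin n)))) h
    (Homeomorph.smulOfNeZero r hr.ne').toMeasurableEquiv
  have h2 : Measure.map (Homeomorph.smulOfNeZero r hr.ne').toMeasurableEquiv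
      (volume : Measure (EuclideanSpace ℝ (Fin n))) = ENNReal.ofReal ((r ^ n)⁻¹) • volume := by
    have := Measure.map_addHaar_smul (volume : Measure (EuclideanSpace ℝ (Fin n))) hr.ne'
    rw [finrank_euclideanSpace_fin, abs_of_pos (by positivity)] at this
    exact this
  rw [h2, lintegral_smul_measure] at h1
  exact h1.symm

theorem lintegral_expMeasure_scale {a : ℝ} (ha : 0 < a) (g : EuclideanSpace ℝ (Fin n) → ℝ≥0∞) :
    ∫⁻ x, g x ∂(expMeasure n a) = ∫⁻ x, g (a⁻¹ • x) ∂(expMeasure n 1) := by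
  have h := lintegral_comp_smul
    (fun x => ENNReal.ofReal (expConst n 1 * Real.exp (-(a * ‖x‖))) * g x) (inv_pos.2 ha)
  have h1 : ∀ x : EuclideanSpace ℝ (Fin n), a * ‖a⁻¹ • x‖ = 1 * ‖x‖ := by
    intro x
    rw [norm_smul, Real.norm_of_nonneg (inv_pos.2 ha).le, ← mul_assoc, mul_inv_cancel₀ ha.ne']
  simp only [h1] at h
  rw [lintegral_expMeasure, lintegral_expMeasure, h, ← lintegral_const_mul' _ _ ENNReal.ofReal_ne_top]
  refine lintegral_congr fun x => ?_
  rw [← mul_assoc, ← ENNReal.ofReal_mul (by positivity), ← mul_assoc]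
  congr 3
  rw [inv_pow, inv_inv, expConst, expConst]
  ring

theorem laplace_expMeasure_one {ξ : EuclideanSpace ℝ (Fin n)} (hξ : ‖ξ‖ < 1) :
    laplace (expMeasure n 1) ξ = ENNReal.ofReal (((√(1 - ‖ξ‖ ^ 2)) ^ (n + 1))⁻¹) := by
  have hω := volume_unit_ball_toReal_pos n
  have h := lintegral_exp_inner_sub_norm hξ
  rw [finrank_euclideanSpace_fin] at h
  rw [laplace, lintegral_expMeasure]
  have h1 : ∀ x : EuclideanSpace ℝ (Fin n),
      ENNReal.ofReal (expConst n 1 * Real.exp (-(1 * ‖x‖))) * ENNReal.ofReal (Real.exp ⟪x, ξ⟫) =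
      ENNReal.ofReal (expConst n 1) * ENNReal.ofReal (Real.exp (⟪x, ξ⟫ - ‖x‖)) := by
    intro x
    have := expConst_pos n one_pos
    rw [← ENNReal.ofReal_mul (by positivity), ← ENNReal.ofReal_mul this.le, mul_assoc,
      ← Real.exp_add]
    congr 3
    ring
  simp_rw [h1]
  rw [lintegral_const_mul' _ _ ENNReal.ofReal_ne_top, h,
    ← ENNReal.ofReal_toReal (measure_ball_lt_top (x := (0 : EuclideanSpace ℝ (Fin n)))).ne,
    ← ENNReal.ofReal_mul (by positivity), ← ENNReal.ofReal_mul (by positivity),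
    ← ENNReal.ofReal_mul (expConst_pos n one_pos).le]
  congr 1
  rw [expConst, one_pow]
  field_simp

theorem expMeasure_one_univ : expMeasure n 1 Set.univ = 1 := by
  have h := laplace_expMeasure_one (n := n) (ξ := 0) (by simp)
  simpa [laplace] using h

theorem isProbabilityMeasure_expMeasure {a : ℝ} (ha : 0 < a) :
    IsProbabilityMeasure (expMeasure n a) := by
  constructor
  have := lintegral_expMeasure_scale (n := n) ha 1
  simpa [expMeasure_one_univ] using this

/-- Pointwise, `e^{ts} ≤ max(1, e^s)` for `t ∈ [0, 1]`. A finite value at `ξ` thus bounds the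
transform on the whole segment from `0` to `ξ`. -/
theorem laplace_smul_le_add_one (μ : Measure (EuclideanSpace ℝ (Fin n))) [IsProbabilityMeasure μ]
    (ξ : EuclideanSpace ℝ (Fin n)) {t : ℝ} (ht0 : 0 ≤ t) (ht1 : t ≤ 1) :
    laplace μ (t • ξ) ≤ laplace μ ξ + 1 := by
  calc laplace μ (t • ξ) ≤ ∫⁻ x, (ENNReal.ofReal (Real.exp ⟪x, ξ⟫) + 1) ∂μ := by
        refine lintegral_mono fun x => ?_
        rw [← ENNReal.ofReal_one, ← ENNReal.ofReal_add (Real.exp_pos _).le zero_le_one]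
        refine ENNReal.ofReal_le_ofReal ?_
        rw [inner_smul_right]
        rcases le_total 0 (⟪x, ξ⟫ : ℝ) with h | h
        · have := Real.exp_le_exp.2 (mul_le_of_le_one_left h ht1)
          linarith
        · have := Real.exp_le_one_iff.2 (mul_nonpos_of_nonneg_of_nonpos ht0 h)
          have := Real.exp_pos (⟪x, ξ⟫ : ℝ)
          linarith
    _ = laplace μ ξ + 1 := by
        rw [lintegral_add_right _ measurable_const]
        simp [laplace]

/-- A finite value would bound the transform along the segment to `ξ`, while the explicit formula
blows up as the norm tends to `1`. -/
theorem laplace_expMeasure_one_eq_top {ξ : EuclideanSpace ℝ (Fin n)} (hξ : 1 ≤ ‖ξ‖) :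
    laplace (expMeasure n 1) ξ = ⊤ := by
  have := isProbabilityMeasure_expMeasure (n := n) one_pos
  by_contra htop
  have hξ0 : 0 < ‖ξ‖ := one_pos.trans_le hξ
  have hbound : ∀ s : ℝ, 0 ≤ s → s < 1 → ((√(1 - s ^ 2)) ^ (n + 1))⁻¹ ≤
      (laplace (expMeasure n 1) ξ + 1).toReal := by
    intro s hs0 hs1
    have hn : ‖(s / ‖ξ‖) • ξ‖ = s := by
      rw [norm_smul, Real.norm_of_nonneg (by positivity), div_mul_cancel₀ _ hξ0.ne']
    have h1 := laplace_smul_le_add_one (expMeasure n 1) ξ (t := s / ‖ξ‖) (by positivity)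
      ((div_le_one hξ0).2 (hs1.le.trans hξ))
    rw [laplace_expMeasure_one (by rw [hn]; exact hs1), hn] at h1
    exact (ENNReal.ofReal_le_iff_le_toReal (by simp [htop])).1 h1
  have hlim : Filter.Tendsto (fun s : ℝ => ((√(1 - s ^ 2)) ^ (n + 1))⁻¹)
      (nhdsWithin 1 (Set.Ioo 0 1)) Filter.atTop := by
    refine Filter.Tendsto.inv_tendsto_nhdsGT_zero (tendsto_nhdsWithin_iff.2 ⟨?_, ?_⟩)
    · have : Continuous fun s : ℝ => (√(1 - s ^ 2)) ^ (n + 1) := by fun_prop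
      have h := this.tendsto 1
      simp only [one_pow, sub_self, Real.sqrt_zero, ne_eq, Nat.add_eq_zero_iff, one_ne_zero,
        and_false, not_false_eq_true, zero_pow] at h
      exact h.mono_left nhdsWithin_le_nhds
    · filter_upwards [self_mem_nhdsWithin] with s hs
      have : 0 < 1 - s ^ 2 := by nlinarith [hs.1, hs.2]
      exact pow_pos (Real.sqrt_pos.2 this) _
  have hne : (nhdsWithin (1 : ℝ) (Set.Ioo 0 1)).NeBot := by
    rw [nhdsWithin_Ioo_eq_nhdsLT one_pos]
    infer_instance
  obtain ⟨s, hs, hs'⟩ := ((hlim.eventually_gt_atTop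
    (laplace (expMeasure n 1) ξ + 1).toReal).and self_mem_nhdsWithin).exists
  exact absurd (hbound s hs'.1.le hs'.2) (not_le.2 hs)

theorem exp_neg_cramer_expMeasure_scale {a : ℝ} (ha : 0 < a) (x : EuclideanSpace ℝ (Fin n)) :
    EReal.exp (-cramer (expMeasure n a) x) = EReal.exp (-cramer (expMeasure n 1) (a • x)) := by
  rw [exp_neg_cramer, exp_neg_cramer]
  refine (Equiv.iInf_congr (Homeomorph.smulOfNeZero a ha.ne').toEquiv fun ξ => ?_).symm
  have h1 : ((Homeomorph.smulOfNeZero a ha.ne').toEquiv ξ) = a • ξ := rfl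
  rw [h1, laplace, lintegral_expMeasure_scale ha, laplace]
  simp only [inner_smul_left, inner_smul_right, conj_trivial]
  simp [ha.ne']

theorem lintegral_exp_neg_cramer_expMeasure {a : ℝ} (ha : 0 < a) :
    ∫⁻ x, EReal.exp (-cramer (expMeasure n a) x) ∂(expMeasure n a) =
      ∫⁻ x, EReal.exp (-cramer (expMeasure n 1) x) ∂(expMeasure n 1) := by
  rw [lintegral_expMeasure_scale ha]
  refine lintegral_congr fun x => ?_
  rw [exp_neg_cramer_expMeasure_scale ha, smul_smul, mul_inv_cancel₀ ha.ne', one_smul]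

end Cramer

/-! ### Explicit Cramér transform of the radial exponential law and its convexity in the squared
norm -/

section CramerProfile

/-- The minimiser of `w ↦ y w / (2N) + (N/2) (1/w - 1 + log w)`. -/
noncomputable def cramerWeight (N y : ℝ) : ℝ := 2 * N / (N + √(N ^ 2 + 4 * y))

/-- The exponential functions of `y = |x|²` whose supremum over `w` is `e^{-Λ*(x)}` for the radial
exponential law in dimension `N - 1`. -/
noncomputable def cramerMinorant (N w y : ℝ) : ℝ :=
  Real.exp (-(y * w / (2 * N) + N / 2 * (w⁻¹ - 1 + Real.log w)))

/-- The function of `y = |x|²` equal to `e^{-Λ*(x)}` for the radial exponential law in dimension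
`N - 1`. -/
noncomputable def cramerProfile (N y : ℝ) : ℝ := cramerMinorant N (cramerWeight N y) y

variable {n : ℕ} {N w y : ℝ}

theorem cramerWeight_pos (hN : 0 < N) : 0 < cramerWeight N y := by
  unfold cramerWeight
  positivity

/-- The optimal dual vector is `ξ = (w / N) x`, and this quadratic equation says `1 - |ξ|² = w`
there. -/
theorem cramerWeight_quadratic (hN : 0 < N) (hy : 0 ≤ y) :
    1 - (cramerWeight N y / N) ^ 2 * y = cramerWeight N y := by
  have h1 : √(N ^ 2 + 4 * y) ^ 2 = N ^ 2 + 4 * y := Real.sq_sqrt (by positivity)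
  have h2 : 0 < N + √(N ^ 2 + 4 * y) := by positivity
  unfold cramerWeight
  field_simp
  linear_combination h1

theorem inv_sqrt_pow_eq_exp {v : ℝ} (hv : 0 < v) (k : ℕ) :
    ((√v) ^ k)⁻¹ = Real.exp (-((k : ℝ) / 2 * Real.log v)) := by
  rw [Real.exp_neg, Real.sqrt_eq_rpow, ← Real.rpow_natCast, ← Real.rpow_mul hv.le,
    Real.rpow_def_of_pos hv]
  congr 2
  ring

/-- Replace `log(1 - s²)` by its tangent line at `w`; the exponents then differ by a perfect square.
Equality holds when `w = 1 - s²` and `s = R w / N`. -/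
theorem cramerMinorant_le (hN : 0 < N) (hw : 0 < w) {R s : ℝ} (hs0 : 0 ≤ s) (hs1 : s < 1) :
    cramerMinorant N w (R ^ 2) ≤ Real.exp (-(R * s) - N / 2 * Real.log (1 - s ^ 2)) := by
  have hv : 0 < 1 - s ^ 2 := by nlinarith
  refine Real.exp_le_exp.2 ?_
  have h1 : Real.log ((1 - s ^ 2) / w) ≤ (1 - s ^ 2) / w - 1 := Real.log_le_sub_one_of_pos (by positivity)
  rw [Real.log_div hv.ne' hw.ne'] at h1
  have h2 : N / 2 * Real.log (1 - s ^ 2) ≤ N / 2 * (Real.log w + (1 - s ^ 2) / w - 1) :=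
    mul_le_mul_of_nonneg_left (by linarith) (by positivity)
  have h3 : R ^ 2 * w / (2 * N) + N / 2 * (w⁻¹ - 1 + Real.log w) - R * s -
      N / 2 * (Real.log w + (1 - s ^ 2) / w - 1) = (R * w - N * s) ^ 2 / (2 * N * w) := by
    field_simp
    ring
  have h4 : 0 ≤ (R * w - N * s) ^ 2 / (2 * N * w) := by positivity
  linarith

theorem cramerProfile_eq (hN : 0 < N) (hy : 0 ≤ y) :
    cramerProfile N y =
      Real.exp (-(cramerWeight N y / N * y) -
        N / 2 * Real.log (1 - (cramerWeight N y / N) ^ 2 * y)) := by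
  have hw := cramerWeight_pos (y := y) hN
  have h := cramerWeight_quadratic hN hy
  rw [cramerProfile, cramerMinorant, h]
  set w := cramerWeight N y
  have h2 : w⁻¹ - 1 = w / N ^ 2 * y := by
    field_simp at h ⊢
    linear_combination h
  congr 1
  rw [h2]
  field_simp
  ring

/-- Evaluate the bound of `cramerMinorant_le` at the optimal `s` for `y`, where its right-hand side
is the profile. -/
theorem cramerMinorant_le_cramerProfile (hN : 0 < N) (hw : 0 < w) (hy : 0 ≤ y) :
    cramerMinorant N w y ≤ cramerProfile N y := by
  have hq := cramerWeight_quadratic hN hy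
  have hw' := cramerWeight_pos (y := y) hN
  have hs : (cramerWeight N y / N * √y) ^ 2 = (cramerWeight N y / N) ^ 2 * y := by
    rw [mul_pow, Real.sq_sqrt hy]
  have h := cramerMinorant_le (R := √y) hN hw (s := cramerWeight N y / N * √y) (by positivity)
    (by
      rw [← sq_lt_one_iff₀ (by positivity), hs]
      linarith)
  rwa [hs, Real.sq_sqrt hy, mul_left_comm, Real.mul_self_sqrt hy, ← cramerProfile_eq hN hy] at h

/-- Each minorant is the exponential of an affine function of `y`, and the profile is their
supremum, attained at `cramerWeight`. It suffices to use the minorant that is optimal at the convex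
combination. -/
theorem convexOn_cramerProfile (hN : 0 < N) : ConvexOn ℝ (Set.Ici 0) (cramerProfile N) := by
  refine ⟨convex_Ici 0, fun y hy z hz a b ha hb hab => ?_⟩
  set w := cramerWeight N (a • y + b • z) with hwdef
  have hw : 0 < w := cramerWeight_pos hN
  have h1 : cramerProfile N (a • y + b • z) ≤
      a • cramerMinorant N w y + b • cramerMinorant N w z := by
    rw [cramerProfile, ← hwdef]
    unfold cramerMinorant
    refine le_trans (Real.exp_le_exp.2 (le_of_eq ?_))
      (convexOn_exp.2 (Set.mem_univ _) (Set.mem_univ _) ha hb hab)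
    simp only [smul_eq_mul]
    linear_combination N / 2 * (w⁻¹ - 1 + Real.log w) * hab
  refine h1.trans (add_le_add ?_ ?_)
  · exact mul_le_mul_of_nonneg_left (cramerMinorant_le_cramerProfile hN hw hy) ha
  · exact mul_le_mul_of_nonneg_left (cramerMinorant_le_cramerProfile hN hw hz) hb

theorem continuous_cramerProfile (hN : 0 < N) : Continuous (cramerProfile N) := by
  have h1 : Continuous (cramerWeight N) := by
    unfold cramerWeight
    refine Continuous.div (by fun_prop) (by fun_prop) fun y => ?_
    positivity
  have h2 : ∀ y, cramerWeight N y ≠ 0 := fun y => (cramerWeight_pos hN).ne'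
  unfold cramerProfile cramerMinorant
  refine Real.continuous_exp.comp (Continuous.neg ?_)
  exact ((continuous_id.mul h1).div_const _).add (continuous_const.mul
    (((h1.inv₀ h2).sub continuous_const).add (h1.log h2)))

theorem cramerProfile_nonneg : 0 ≤ cramerProfile N y := (Real.exp_pos _).le

theorem exp_neg_cramer_expMeasure_one (x : EuclideanSpace ℝ (Fin n)) :
    EReal.exp (-cramer (expMeasure n 1) x) =
      ENNReal.ofReal (cramerProfile ((n : ℝ) + 1) (‖x‖ ^ 2)) := by
  have hN : (0 : ℝ) < (n : ℝ) + 1 := by positivity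
  have hlap : ∀ ξ : EuclideanSpace ℝ (Fin n), ‖ξ‖ < 1 →
      ENNReal.ofReal (Real.exp (-⟪x, ξ⟫)) * laplace (expMeasure n 1) ξ =
      ENNReal.ofReal (Real.exp (-⟪x, ξ⟫ - ((n : ℝ) + 1) / 2 * Real.log (1 - ‖ξ‖ ^ 2))) := by
    intro ξ hξ
    have hv : 0 < 1 - ‖ξ‖ ^ 2 := by nlinarith [norm_nonneg ξ]
    rw [laplace_expMeasure_one hξ, ← ENNReal.ofReal_mul (Real.exp_pos _).le,
      inv_sqrt_pow_eq_exp hv, ← Real.exp_add, Nat.cast_add_one, ← sub_eq_add_neg]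
  rw [exp_neg_cramer]
  refine le_antisymm ?_ (le_iInf fun ξ => ?_)
  · set w := cramerWeight ((n : ℝ) + 1) (‖x‖ ^ 2) with hw
    have hq := cramerWeight_quadratic hN (sq_nonneg ‖x‖)
    have hw0 : 0 < w := cramerWeight_pos hN
    rw [← hw] at hq
    have hnorm : ‖(w / ((n : ℝ) + 1)) • x‖ ^ 2 = (w / ((n : ℝ) + 1)) ^ 2 * ‖x‖ ^ 2 := by
      rw [norm_smul, mul_pow, Real.norm_eq_abs, sq_abs]
    refine (iInf_le _ ((w / ((n : ℝ) + 1)) • x)).trans ?_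
    rw [hlap _ (by rw [← sq_lt_one_iff₀ (norm_nonneg _), hnorm]; linarith), hnorm,
      cramerProfile_eq hN (sq_nonneg _), inner_smul_right, real_inner_self_eq_norm_sq]
  · rcases lt_or_ge ‖ξ‖ 1 with hξ | hξ
    · rw [hlap ξ hξ]
      refine ENNReal.ofReal_le_ofReal ((cramerMinorant_le hN (cramerWeight_pos hN) (norm_nonneg ξ)
        hξ).trans (Real.exp_le_exp.2 ?_))
      have := real_inner_le_norm x ξ
      linarith
    · rw [laplace_expMeasure_one_eq_top hξ, ENNReal.mul_top (by simp [Real.exp_pos])]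
      exact le_top

end CramerProfile

/-! ### Crossing argument for radial densities -/

section Comparison

variable {n : ℕ}

theorem ConvexOn.exists_chord {φ : ℝ → ℝ} {s : Set ℝ} (hφ : ConvexOn ℝ s φ) {p q : ℝ} (hp : p ∈ s)
    (hq : q ∈ s) (hpq : p < q) :
    ∃ m, ∀ y ∈ s, (p ≤ y → y ≤ q → φ y ≤ φ p + m * (y - p)) ∧
      (y ≤ p ∨ q ≤ y → φ p + m * (y - p) ≤ φ y) := by
  refine ⟨(φ q - φ p) / (q - p), fun y hy => ?_⟩
  rcases lt_trichotomy y p with h | rfl | h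
  · refine ⟨fun h' => absurd h' (not_le.2 h), fun _ => ?_⟩
    have := hφ.secant_mono hp hy hq h.ne hpq.ne' (h.trans hpq).le
    rw [div_le_iff_of_neg (sub_neg.2 h)] at this
    linarith
  · simp
  · refine ⟨fun _ h2 => ?_, fun h' => ?_⟩
    · have := hφ.secant_mono hp hy hq h.ne' hpq.ne' h2
      rw [div_le_iff₀ (sub_pos.2 h)] at this
      linarith
    · have h2 : q ≤ y := h'.resolve_left (not_le.2 h)
      have := hφ.secant_mono hp hq hy hpq.ne' h.ne' h2
      rw [le_div_iff₀ (sub_pos.2 h)] at this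
      linarith

/-- An order-connected set of nonnegative reals is, up to endpoints, at most a point, a half-line
or a bounded interval. -/
theorem ordConnected_nonneg_cases {S : Set ℝ} (hS : S.OrdConnected) (hS0 : ∀ r ∈ S, 0 ≤ r) :
    (∃ c, ∀ r, r ≠ c → r ∉ S) ∨
    (∃ c, 0 ≤ c ∧ (∀ r, c < r → r ∈ S) ∧ ∀ r, r < c → r ∉ S) ∨
    (∃ c d, 0 ≤ c ∧ c < d ∧ (∀ r ∈ S, c ≤ r ∧ r ≤ d) ∧ ∀ r, c < r → r < d → r ∈ S) := by
  rcases S.eq_empty_or_nonempty with rfl | hne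
  · exact .inl ⟨0, by simp⟩
  have hbb : BddBelow S := ⟨0, hS0⟩
  have hlow : ∀ r, sInf S < r → ∃ s ∈ S, s < r := fun r hr => exists_lt_of_csInf_lt hne hr
  by_cases hba : BddAbove S
  · have hle : sInf S ≤ sSup S := csInf_le_csSup hne hbb hba
    rcases hle.eq_or_lt with h | h
    · refine .inl ⟨sInf S, fun r hr hrS => hr ?_⟩
      exact le_antisymm (h ▸ le_csSup hba hrS) (csInf_le hbb hrS)
    · refine .inr (.inr ⟨sInf S, sSup S, le_csInf hne hS0, h,
        fun r hr => ⟨csInf_le hbb hr, le_csSup hba hr⟩, fun r h1 h2 => ?_⟩)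
      obtain ⟨s, hs, hsr⟩ := hlow r h1
      obtain ⟨t, ht, hrt⟩ := exists_lt_of_lt_csSup hne h2
      exact hS.out hs ht ⟨hsr.le, hrt.le⟩
  · refine .inr (.inl ⟨sInf S, le_csInf hne hS0, fun r hr => ?_,
      fun r hr hrS => not_le.2 hr (csInf_le hbb hrS)⟩)
    obtain ⟨s, hs, hsr⟩ := hlow r hr
    obtain ⟨t, ht, hrt⟩ := not_bddAbove_iff.1 hba r
    exact hS.out hs ht ⟨hsr.le, hrt.le⟩

/-- Half of the exponential decay absorbs `|x|²`, leaving a multiple of the probability density with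
rate `a / 2`. -/
theorem lintegral_sq_norm_expMeasure_lt_top {a : ℝ} (ha : 0 < a) :
    ∫⁻ x, ENNReal.ofReal (‖x‖ ^ 2) ∂(expMeasure n a) < ⊤ := by
  have hprob := isProbabilityMeasure_expMeasure (n := n) (half_pos ha)
  have hK := expConst_pos n ha
  have hK' := expConst_pos n (half_pos ha)
  set C := expConst n a * (8 / a ^ 2) / expConst n (a / 2) with hC
  have hle : ∫⁻ x, ENNReal.ofReal (‖x‖ ^ 2) ∂(expMeasure n a) ≤
      ∫⁻ _x, ENNReal.ofReal C ∂(expMeasure n (a / 2)) := by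
    rw [lintegral_expMeasure, lintegral_expMeasure]
    refine lintegral_mono fun x => ?_
    rw [← ENNReal.ofReal_mul (by positivity), ← ENNReal.ofReal_mul (by positivity)]
    refine ENNReal.ofReal_le_ofReal ?_
    have h1 := Real.quadratic_le_exp_of_nonneg (x := a / 2 * ‖x‖) (by positivity)
    have h2 : ‖x‖ ^ 2 ≤ 8 / a ^ 2 * Real.exp (a / 2 * ‖x‖) := by
      have h3 : 8 / a ^ 2 * ((a / 2 * ‖x‖) ^ 2 / 2) = ‖x‖ ^ 2 := by
        field_simp
        ring
      rw [← h3]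
      refine mul_le_mul_of_nonneg_left ?_ (by positivity)
      have : 0 ≤ a / 2 * ‖x‖ := by positivity
      linarith
    have h4 : Real.exp (-(a * ‖x‖)) * Real.exp (a / 2 * ‖x‖) = Real.exp (-(a / 2 * ‖x‖)) := by
      rw [← Real.exp_add]
      congr 1
      ring
    calc expConst n a * Real.exp (-(a * ‖x‖)) * ‖x‖ ^ 2
        ≤ expConst n a * Real.exp (-(a * ‖x‖)) * (8 / a ^ 2 * Real.exp (a / 2 * ‖x‖)) := by gcongr
      _ = expConst n a * (8 / a ^ 2) * (Real.exp (-(a * ‖x‖)) * Real.exp (a / 2 * ‖x‖)) := by ring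
      _ = _ := by
        rw [h4, hC]
        field_simp
  refine hle.trans_lt ?_
  simp

/-- Affine functions of `|x|²` integrate to zero against `g - f`, since masses and second moments
agree. -/
theorem integral_sub_affine_mul_sub {f g φ : EuclideanSpace ℝ (Fin n) → ℝ} (hf : Integrable f)
    (hg : Integrable g) (hf2 : Integrable fun x => ‖x‖ ^ 2 * f x)
    (hg2 : Integrable fun x => ‖x‖ ^ 2 * g x) (h0 : ∫ x, f x = ∫ x, g x)
    (h2 : ∫ x, ‖x‖ ^ 2 * f x = ∫ x, ‖x‖ ^ 2 * g x) (hφf : Integrable fun x => φ x * f x)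
    (hφg : Integrable fun x => φ x * g x) (α m : ℝ) :
    Integrable (fun x => (φ x - (α + m * ‖x‖ ^ 2)) * (g x - f x)) ∧
      ∫ x, (φ x - (α + m * ‖x‖ ^ 2)) * (g x - f x) = (∫ x, φ x * g x) - ∫ x, φ x * f x := by
  have heq : (fun x => (φ x - (α + m * ‖x‖ ^ 2)) * (g x - f x)) = fun x =>
      (φ x * g x - φ x * f x) - (α * (g x - f x) + m * (‖x‖ ^ 2 * g x - ‖x‖ ^ 2 * f x)) := by
    ext x
    ring
  have i1 : Integrable fun x => φ x * g x - φ x * f x := hφg.sub hφf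
  have i2 : Integrable fun x => α * (g x - f x) := (hg.sub hf).const_mul _
  have i3 : Integrable fun x => m * (‖x‖ ^ 2 * g x - ‖x‖ ^ 2 * f x) := (hg2.sub hf2).const_mul _
  have i4 : Integrable fun x => α * (g x - f x) + m * (‖x‖ ^ 2 * g x - ‖x‖ ^ 2 * f x) := i2.add i3
  rw [heq]
  refine ⟨i1.sub i4, ?_⟩
  rw [integral_sub i1 i4, integral_add i2 i3, integral_const_mul, integral_const_mul,
    integral_sub hφg hφf, integral_sub hg hf, integral_sub hg2 hf2, h0, h2]
  simp

theorem ae_norm_ne (hn : 1 ≤ n) (c : ℝ) : ∀ᵐ x : EuclideanSpace ℝ (Fin n), ‖x‖ ≠ c := by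
  have : Nonempty (Fin n) := ⟨⟨0, hn⟩⟩
  filter_upwards [measure_eq_zero_iff_ae_notMem.1
    (Measure.addHaar_sphere volume (0 : EuclideanSpace ℝ (Fin n)) c)] with x hx
  simpa using hx

/-- If the difference of two densities with the same mass and second moment has the sign of
`|x| - c`, then they agree almost everywhere. -/
theorem ae_eq_of_sign_change {f g : EuclideanSpace ℝ (Fin n) → ℝ} (hn : 1 ≤ n) (hf : Integrable f)
    (hg : Integrable g) (hf2 : Integrable fun x => ‖x‖ ^ 2 * f x)
    (hg2 : Integrable fun x => ‖x‖ ^ 2 * g x) (h0 : ∫ x, f x = ∫ x, g x)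
    (h2 : ∫ x, ‖x‖ ^ 2 * f x = ∫ x, ‖x‖ ^ 2 * g x) {c : ℝ} (hc : 0 ≤ c)
    (hgt : ∀ x, c < ‖x‖ → g x ≤ f x) (hlt : ∀ x, ‖x‖ < c → f x ≤ g x) :
    f =ᵐ[volume] g := by
  -- Test against `c² - |x|²`, which has the same sign as `g - f`: a nonnegative integrand with zero
  -- integral vanishes almost everywhere.
  obtain ⟨hint, hzero⟩ := integral_sub_affine_mul_sub (φ := 0) hf hg hf2 hg2 h0 h2 (by simp)
    (by simp) (-c ^ 2) 1
  simp only [Pi.zero_apply, zero_mul, sub_self, integral_zero] at hint hzero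
  have hnn : ∀ x, 0 ≤ (0 - (-c ^ 2 + 1 * ‖x‖ ^ 2)) * (g x - f x) := by
    intro x
    have hx := norm_nonneg x
    rcases lt_trichotomy ‖x‖ c with h | h | h
    · exact mul_nonneg (by nlinarith) (sub_nonneg.2 (hlt x h))
    · simp [h]
    · exact mul_nonneg_of_nonpos_of_nonpos (by nlinarith) (sub_nonpos.2 (hgt x h))
  filter_upwards [(integral_eq_zero_iff_of_nonneg hnn hint).1 hzero, ae_norm_ne hn c] with x hx hxc
  rcases mul_eq_zero.1 hx with h | h
  · exact absurd ((sq_eq_sq₀ (norm_nonneg x) hc).1 (by linarith)) hxc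
  · linarith

/-- If the density `f` exceeds `g` exactly on a spherical shell and both have the same mass and
second moment, then `g` dominates `f` on nonnegative convex functions of `|x|²`. -/
theorem lintegral_convex_le_of_shell {f g : EuclideanSpace ℝ (Fin n) → ℝ} {φ : ℝ → ℝ} (hn : 1 ≤ n)
    (hf_nonneg : ∀ x, 0 ≤ f x) (hg_nonneg : ∀ x, 0 ≤ g x) (hf : Integrable f)
    (hg : Integrable g) (hf2 : Integrable fun x => ‖x‖ ^ 2 * f x)
    (hg2 : Integrable fun x => ‖x‖ ^ 2 * g x) (h0 : ∫ x, f x = ∫ x, g x)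
    (h2 : ∫ x, ‖x‖ ^ 2 * f x = ∫ x, ‖x‖ ^ 2 * g x) (hφ : ConvexOn ℝ (Set.Ici 0) φ)
    (hφ0 : ∀ y, 0 ≤ y → 0 ≤ φ y)
    (hφc : Continuous fun x : EuclideanSpace ℝ (Fin n) => φ (‖x‖ ^ 2)) {c d : ℝ} (hc : 0 ≤ c)
    (hcd : c < d) (hin : ∀ x, c < ‖x‖ → ‖x‖ < d → g x ≤ f x)
    (hout : ∀ x, ‖x‖ < c ∨ d < ‖x‖ → f x ≤ g x) :
    ∫⁻ x, ENNReal.ofReal (φ (‖x‖ ^ 2) * f x) ≤ ∫⁻ x, ENNReal.ofReal (φ (‖x‖ ^ 2) * g x) := by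
  have hφx : ∀ x : EuclideanSpace ℝ (Fin n), 0 ≤ φ (‖x‖ ^ 2) := fun x => hφ0 _ (sq_nonneg _)
  by_cases htop : ∫⁻ x, ENNReal.ofReal (φ (‖x‖ ^ 2) * g x) = ⊤
  · rw [htop]
    exact le_top
  have hφg : Integrable fun x => φ (‖x‖ ^ 2) * g x :=
    (lintegral_ofReal_ne_top_iff_integrable (hφc.aestronglyMeasurable.mul hg.1)
      (Filter.Eventually.of_forall fun x => mul_nonneg (hφx x) (hg_nonneg x))).1 htop
  have hc2 : c ^ 2 < d ^ 2 := by nlinarith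
  obtain ⟨m, hm⟩ := hφ.exists_chord (Set.mem_Ici.2 (sq_nonneg c)) (Set.mem_Ici.2 (sq_nonneg d)) hc2
  -- Inside the shell the chord bounds `φ` by a constant; outside it `f ≤ g`, so `φ g` dominates.
  have hφf : Integrable fun x => φ (‖x‖ ^ 2) * f x := by
    refine (hφg.add (hf.const_mul (φ (c ^ 2) + |m| * (d ^ 2 - c ^ 2)))).mono'
      (hφc.aestronglyMeasurable.mul hf.1) ?_
    filter_upwards [ae_norm_ne hn c, ae_norm_ne hn d] with x hxc hxd
    rw [Real.norm_of_nonneg (mul_nonneg (hφx x) (hf_nonneg x)), Pi.add_apply]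
    have hb : 0 ≤ φ (c ^ 2) + |m| * (d ^ 2 - c ^ 2) :=
      add_nonneg (hφ0 _ (sq_nonneg c)) (mul_nonneg (abs_nonneg _) (by linarith))
    by_cases hx : c < ‖x‖ ∧ ‖x‖ < d
    · have h1 : c ^ 2 ≤ ‖x‖ ^ 2 := by nlinarith
      have h3 : ‖x‖ ^ 2 ≤ d ^ 2 := by nlinarith [norm_nonneg x]
      have h4 := (hm (‖x‖ ^ 2) (Set.mem_Ici.2 (sq_nonneg _))).1 h1 h3
      have h5 : m * (‖x‖ ^ 2 - c ^ 2) ≤ |m| * (d ^ 2 - c ^ 2) :=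
        mul_le_mul (le_abs_self m) (by linarith) (by linarith) (abs_nonneg m)
      have h6 := mul_le_mul_of_nonneg_right (h4.trans (add_le_add_right h5 _)) (hf_nonneg x)
      have h7 := mul_nonneg (hφx x) (hg_nonneg x)
      linarith
    · have hx' : ‖x‖ < c ∨ d < ‖x‖ := by
        by_contra! h
        exact hx ⟨lt_of_le_of_ne h.1 hxc.symm, lt_of_le_of_ne h.2 hxd⟩
      have h6 := mul_le_mul_of_nonneg_left (hout x hx') (hφx x)
      have h7 := mul_nonneg hb (hf_nonneg x)
      linarith
  -- The subtracted affine function is the chord of `φ` over `[c², d²]`. Both `φ` minus the chord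
  -- and `g - f` are nonpositive inside the shell and nonnegative outside.
  obtain ⟨-, hint⟩ := integral_sub_affine_mul_sub hf hg hf2 hg2 h0 h2 hφf hφg
    (φ (c ^ 2) - m * c ^ 2) m
  have hnn : 0 ≤ ∫ x, (φ (‖x‖ ^ 2) - (φ (c ^ 2) - m * c ^ 2 + m * ‖x‖ ^ 2)) * (g x - f x) := by
    refine integral_nonneg_of_ae ?_
    filter_upwards [ae_norm_ne hn c, ae_norm_ne hn d] with x hxc hxd
    have hmx := hm (‖x‖ ^ 2) (Set.mem_Ici.2 (sq_nonneg _))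
    by_cases hx : c < ‖x‖ ∧ ‖x‖ < d
    · have h1 : c ^ 2 ≤ ‖x‖ ^ 2 := by nlinarith
      have h3 : ‖x‖ ^ 2 ≤ d ^ 2 := by nlinarith [norm_nonneg x]
      have h4 := hmx.1 h1 h3
      exact mul_nonneg_of_nonpos_of_nonpos (by linarith) (sub_nonpos.2 (hin x hx.1 hx.2))
    · have hx' : ‖x‖ < c ∨ d < ‖x‖ := by
        by_contra! h
        exact hx ⟨lt_of_le_of_ne h.1 hxc.symm, lt_of_le_of_ne h.2 hxd⟩
      have h4 := hmx.2 (hx'.imp (fun h => by nlinarith [norm_nonneg x])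
        fun h => by nlinarith [norm_nonneg x])
      exact mul_nonneg (by linarith) (sub_nonneg.2 (hout x hx'))
  rw [hint] at hnn
  rw [← ofReal_integral_eq_lintegral_ofReal hφf (Filter.Eventually.of_forall fun x =>
      mul_nonneg (hφx x) (hf_nonneg x)),
    ← ofReal_integral_eq_lintegral_ofReal hφg (Filter.Eventually.of_forall fun x =>
      mul_nonneg (hφx x) (hg_nonneg x))]
  exact ENNReal.ofReal_le_ofReal (by linarith)

/-- Among radial log-concave densities with a given second moment, the radial exponential one is
the largest on nonnegative convex functions of `|x|²`. -/
theorem lintegral_convex_le_expMeasure {a : ℝ} (ha : 0 < a) (hn : 1 ≤ n)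
    {f : EuclideanSpace ℝ (Fin n) → ℝ} (hf_nonneg : ∀ x, 0 ≤ f x) (hfm : Measurable f)
    (hrad : ∀ x y, ‖x‖ = ‖y‖ → f x = f y)
    (hlc : ∀ x y (t : ℝ), 0 < t → t < 1 → f x ^ (1 - t) * f y ^ t ≤ f ((1 - t) • x + t • y))
    (hmass : ∫⁻ x, ENNReal.ofReal (f x) = 1)
    (hmom : ∫⁻ x, ENNReal.ofReal (‖x‖ ^ 2 * f x) =
      ∫⁻ x, ENNReal.ofReal (‖x‖ ^ 2) ∂(expMeasure n a))
    {φ : ℝ → ℝ} (hφ : ConvexOn ℝ (Set.Ici 0) φ) (hφ0 : ∀ y, 0 ≤ y → 0 ≤ φ y)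
    (hφc : Continuous fun x : EuclideanSpace ℝ (Fin n) => φ (‖x‖ ^ 2)) :
    ∫⁻ x, ENNReal.ofReal (φ (‖x‖ ^ 2) * f x) ≤
      ∫⁻ x, ENNReal.ofReal (φ (‖x‖ ^ 2)) ∂(expMeasure n a) := by
  have hK := expConst_pos n ha
  set γ : ℝ → ℝ := fun r => expConst n a * Real.exp (-(a * r)) with hγ
  have hγ0 : ∀ r, 0 < γ r := fun r => by positivity
  have hγc : Continuous γ := by fun_prop
  have hconv : ∀ ψ : EuclideanSpace ℝ (Fin n) → ℝ, (∀ x, 0 ≤ ψ x) →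
      ∫⁻ x, ENNReal.ofReal (ψ x) ∂(expMeasure n a) = ∫⁻ x, ENNReal.ofReal (ψ x * γ ‖x‖) := by
    intro ψ hψ
    rw [lintegral_expMeasure]
    refine lintegral_congr fun x => ?_
    rw [mul_comm, ENNReal.ofReal_mul (hψ x)]
  have hmassγ : ∫⁻ x : EuclideanSpace ℝ (Fin n), ENNReal.ofReal (γ ‖x‖) = 1 := by
    have := isProbabilityMeasure_expMeasure (n := n) ha
    have h := hconv (fun _ => 1) fun _ => zero_le_one
    simpa using h.symm
  have hfin := lintegral_sq_norm_expMeasure_lt_top (n := n) ha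
  rw [hconv _ fun x => sq_nonneg _] at hmom hfin
  rw [hconv (fun x => φ (‖x‖ ^ 2)) fun x => hφ0 _ (sq_nonneg _)]
  have hf : Integrable f := (lintegral_ofReal_ne_top_iff_integrable hfm.aestronglyMeasurable
    (Filter.Eventually.of_forall hf_nonneg)).1 (by simp [hmass])
  have hgm : Measurable fun x : EuclideanSpace ℝ (Fin n) => γ ‖x‖ := by fun_prop
  have hg : Integrable fun x : EuclideanSpace ℝ (Fin n) => γ ‖x‖ :=
    (lintegral_ofReal_ne_top_iff_integrable hgm.aestronglyMeasurable
    (Filter.Eventually.of_forall fun x => (hγ0 _).le)).1 (by simp [hmassγ])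
  have hf2n : ∀ x, 0 ≤ ‖x‖ ^ 2 * f x := fun x => mul_nonneg (sq_nonneg _) (hf_nonneg x)
  have hg2n : ∀ x : EuclideanSpace ℝ (Fin n), 0 ≤ ‖x‖ ^ 2 * γ ‖x‖ :=
    fun x => mul_nonneg (sq_nonneg _) (hγ0 _).le
  have hf2m : AEStronglyMeasurable (fun x => ‖x‖ ^ 2 * f x) :=
    ((measurable_norm.pow_const 2).mul hfm).aestronglyMeasurable
  have hg2m : AEStronglyMeasurable fun x : EuclideanSpace ℝ (Fin n) => ‖x‖ ^ 2 * γ ‖x‖ :=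
    ((measurable_norm.pow_const 2).mul hgm).aestronglyMeasurable
  have hf2 : Integrable fun x => ‖x‖ ^ 2 * f x := (lintegral_ofReal_ne_top_iff_integrable hf2m
    (Filter.Eventually.of_forall hf2n)).1 (by rw [hmom]; exact hfin.ne)
  have hg2 : Integrable fun x : EuclideanSpace ℝ (Fin n) => ‖x‖ ^ 2 * γ ‖x‖ :=
    (lintegral_ofReal_ne_top_iff_integrable hg2m (Filter.Eventually.of_forall hg2n)).1 hfin.ne
  have h0 : ∫ x, f x = ∫ x : EuclideanSpace ℝ (Fin n), γ ‖x‖ := by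
    rw [integral_eq_lintegral_of_nonneg_ae (Filter.Eventually.of_forall hf_nonneg) hf.1,
      integral_eq_lintegral_of_nonneg_ae (Filter.Eventually.of_forall fun x => (hγ0 _).le) hg.1,
      hmass, hmassγ]
  have h2 : ∫ x, ‖x‖ ^ 2 * f x = ∫ x : EuclideanSpace ℝ (Fin n), ‖x‖ ^ 2 * γ ‖x‖ := by
    rw [integral_eq_lintegral_of_nonneg_ae (Filter.Eventually.of_forall hf2n) hf2m,
      integral_eq_lintegral_of_nonneg_ae (Filter.Eventually.of_forall hg2n) hg2m, hmom]
  set e : EuclideanSpace ℝ (Fin n) := EuclideanSpace.single ⟨0, hn⟩ 1 with he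
  have he1 : ‖e‖ = 1 := by simp [he]
  have hfe : ∀ x, f x = f (‖x‖ • e) := fun x => hrad _ _ (by simp [norm_smul, he1])
  -- `γ` is log-affine and `r ↦ f (r • e)` is log-concave, so `S` is an interval.
  set S : Set ℝ := {r | 0 ≤ r ∧ γ r < f (r • e)} with hSdef
  have hmem : ∀ x, ‖x‖ ∈ S ↔ γ ‖x‖ < f x := by
    intro x
    rw [hfe x]
    simp [hSdef]
  have hS : S.OrdConnected := by
    refine ⟨fun r₁ h₁ r₂ h₂ r hr => ?_⟩
    rcases hr.1.eq_or_lt with rfl | hr1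
    · exact h₁
    rcases hr.2.eq_or_lt with rfl | hr2
    · exact h₂
    refine ⟨h₁.1.trans hr.1, ?_⟩
    set t := (r - r₁) / (r₂ - r₁) with ht
    have hd : 0 < r₂ - r₁ := by linarith
    have ht0 : 0 < t := div_pos (by linarith) hd
    have ht1 : t < 1 := (div_lt_one hd).2 (by linarith)
    have hrt : (1 - t) * r₁ + t * r₂ = r := by
      rw [ht]
      field_simp
      ring
    have h3 := hlc (r₁ • e) (r₂ • e) t ht0 ht1
    rw [smul_smul, smul_smul, ← add_smul, hrt] at h3
    refine lt_of_lt_of_le ?_ h3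
    have h4 : γ r = γ r₁ ^ (1 - t) * γ r₂ ^ t := by
      simp only [hγ]
      rw [Real.mul_rpow hK.le (Real.exp_pos _).le, Real.mul_rpow hK.le (Real.exp_pos _).le,
        ← Real.exp_mul, ← Real.exp_mul, mul_mul_mul_comm, ← Real.rpow_add hK, ← Real.exp_add,
        sub_add_cancel, Real.rpow_one, ← hrt]
      congr 2
      ring
    rw [h4]
    exact mul_lt_mul'' (Real.rpow_lt_rpow (hγ0 _).le h₁.2 (by linarith))
      (Real.rpow_lt_rpow (hγ0 _).le h₂.2 ht0) (Real.rpow_nonneg (hγ0 _).le _)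
      (Real.rpow_nonneg (hγ0 _).le _)
  have hin : ∀ x, ‖x‖ ∈ S → γ ‖x‖ ≤ f x := fun x hx => ((hmem x).1 hx).le
  have hout : ∀ x, ‖x‖ ∉ S → f x ≤ γ ‖x‖ := fun x hx => not_lt.1 fun h => hx ((hmem x).2 h)
  -- If `S` is at most a point, the densities compare pointwise; if it is a half-line, equal moments
  -- force the densities to agree; a bounded interval is the shell case.
  rcases ordConnected_nonneg_cases hS fun r hr => hr.1 with
    ⟨c, hc⟩ | ⟨c, hc, hgt, hlt⟩ | ⟨c, d, hc, hcd, hsub, hsup⟩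
  · refine lintegral_mono_ae ?_
    filter_upwards [ae_norm_ne hn c] with x hx
    exact ENNReal.ofReal_le_ofReal
      (mul_le_mul_of_nonneg_left (hout x (hc _ hx)) (hφ0 _ (sq_nonneg _)))
  · refine (lintegral_congr_ae ?_).le
    filter_upwards [ae_eq_of_sign_change hn hf hg hf2 hg2 h0 h2 hc
      (fun x hx => hin x (hgt _ hx)) fun x hx => hout x (hlt _ hx)] with x hx
    rw [hx]
  · refine lintegral_convex_le_of_shell hn hf_nonneg (fun x => (hγ0 _).le) hf hg hf2 hg2 h0 h2 hφ
      hφ0 hφc hc hcd (fun x h1 h3 => hin x (hsup _ h1 h3)) fun x hx => hout x fun hxS => ?_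
    have := hsub _ hxS
    rcases hx with hx | hx <;> linarith

end Comparison

/-! ### Finite second moment from log-concavity -/

section Moments

variable {n : ℕ} {μ : Measure (EuclideanSpace ℝ (Fin n))}

theorem exists_linearIsometryEquiv_map_eq {x y : EuclideanSpace ℝ (Fin n)} (h : ‖x‖ = ‖y‖) :
    ∃ U : EuclideanSpace ℝ (Fin n) ≃ₗᵢ[ℝ] EuclideanSpace ℝ (Fin n), U x = y :=
  ⟨_, Submodule.reflection_sub h⟩

theorem IsRotationallyInvariant.lintegral_comp (hrot : IsRotationallyInvariant μ)
    (U : EuclideanSpace ℝ (Fin n) ≃ₗᵢ[ℝ] EuclideanSpace ℝ (Fin n))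
    (g : EuclideanSpace ℝ (Fin n) → ℝ≥0∞) : ∫⁻ x, g (U x) ∂μ = ∫⁻ x, g x ∂μ := by
  have h := lintegral_map_equiv (μ := μ) g U.toHomeomorph.toMeasurableEquiv
  have h2 : μ.map U.toHomeomorph.toMeasurableEquiv = μ := hrot U
  rw [h2] at h
  exact h.symm

theorem IsRotationallyInvariant.measure_ball_eq (hrot : IsRotationallyInvariant μ)
    {x y : EuclideanSpace ℝ (Fin n)} (h : ‖x‖ = ‖y‖) (ε : ℝ) :
    μ (Metric.ball x ε) = μ (Metric.ball y ε) := by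
  obtain ⟨U, rfl⟩ := exists_linearIsometryEquiv_map_eq h
  conv_rhs => rw [← hrot U, Measure.map_apply U.continuous.measurable Metric.isOpen_ball.measurableSet]
  congr 1
  ext z
  simp

/-- The midpoint of a point of norm at least `3r` and a point of norm below `r` has norm at least
`r`; apply log-concavity with `t = 1/2`. -/
theorem IsLogConcave.measure_norm_ge_three_mul (hlc : IsLogConcave μ) (r : ℝ) :
    μ {x | 3 * r ≤ ‖x‖} * μ (Metric.ball 0 r) ≤ μ {x | r ≤ ‖x‖} ^ 2 := by
  have hA : MeasurableSet {x : EuclideanSpace ℝ (Fin n) | 3 * r ≤ ‖x‖} :=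
    measurableSet_le measurable_const measurable_norm
  have h := hlc _ _ hA (Metric.isOpen_ball (x := (0 : EuclideanSpace ℝ (Fin n)))
    (ε := r)).measurableSet (1 / 2) (by norm_num) (by norm_num)
  have hsub : (1 - 1 / 2 : ℝ) • {x : EuclideanSpace ℝ (Fin n) | 3 * r ≤ ‖x‖} +
      (1 / 2 : ℝ) • Metric.ball (0 : EuclideanSpace ℝ (Fin n)) r ⊆ {x | r ≤ ‖x‖} := by
    rintro _ ⟨_, ⟨x, hx, rfl⟩, _, ⟨y, hy, rfl⟩, rfl⟩
    have hx' : 3 * r ≤ ‖x‖ := hx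
    have hy' : ‖y‖ < r := by simpa using hy
    have h1 : ‖(1 - 1 / 2 : ℝ) • x‖ = ‖x‖ / 2 := by
      rw [norm_smul]
      norm_num
      ring
    have h2 : ‖(1 / 2 : ℝ) • y‖ = ‖y‖ / 2 := by
      rw [norm_smul]
      norm_num
      ring
    have h3 := norm_sub_le_norm_add ((1 - 1 / 2 : ℝ) • x) ((1 / 2 : ℝ) • y)
    change r ≤ ‖(1 - 1 / 2 : ℝ) • x + (1 / 2 : ℝ) • y‖
    rw [h1, h2] at h3
    linarith
  have h2 := pow_le_pow_left' (h.trans (measure_mono hsub)) 2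
  rw [mul_pow, ← ENNReal.rpow_natCast, ← ENNReal.rpow_natCast, ← ENNReal.rpow_mul,
    ← ENNReal.rpow_mul] at h2
  norm_num at h2
  exact h2

theorem exists_measure_norm_ge_le [IsFiniteMeasure μ] {δ : ℝ≥0∞} (hδ : 0 < δ) :
    ∃ r : ℝ, 0 < r ∧ μ {x | r ≤ ‖x‖} ≤ δ := by
  have h : Filter.Tendsto (fun k : ℕ => μ {x | (k : ℝ) ≤ ‖x‖}) Filter.atTop
      (nhds (μ (⋂ k : ℕ, {x | (k : ℝ) ≤ ‖x‖}))) :=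
    tendsto_measure_iInter_atTop
      (fun k => (measurableSet_le measurable_const measurable_norm).nullMeasurableSet)
      (fun i j hij x (hx : (j : ℝ) ≤ ‖x‖) =>
        show (i : ℝ) ≤ ‖x‖ from (Nat.cast_le.2 hij).trans hx) ⟨0, measure_ne_top _ _⟩
  have hempty : (⋂ k : ℕ, {x : EuclideanSpace ℝ (Fin n) | (k : ℝ) ≤ ‖x‖}) = ∅ := by
    ext x
    simp only [Set.mem_iInter, Set.mem_ofPred_eq, Set.mem_empty_iff_false, iff_false, not_forall,
      not_le]
    exact exists_nat_gt ‖x‖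
  rw [hempty, measure_empty] at h
  obtain ⟨k, hk, hk0⟩ := ((h.eventually_lt_const hδ).and (Filter.eventually_gt_atTop 0)).exists
  exact ⟨k, Nat.cast_pos.2 hk0, hk.le⟩

theorem IsLogConcave.lintegral_sq_norm_lt_top [IsProbabilityMeasure μ] (hlc : IsLogConcave μ) :
    ∫⁻ x, ENNReal.ofReal (‖x‖ ^ 2) ∂μ < ⊤ := by
  -- A tail below `1/36` shrinks by a factor of at most `1/18` each time the radius triples. Since
  -- `|x|²` grows only by `9`, the dyadic-type sum is geometric with ratio `1/2`.
  obtain ⟨r, hr, hr36⟩ := exists_measure_norm_ge_le (μ := μ) (δ := ENNReal.ofReal (1 / 36))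
    (by norm_num)
  have hmeas : ∀ s : ℝ, MeasurableSet {x : EuclideanSpace ℝ (Fin n) | s ≤ ‖x‖} :=
    fun s => measurableSet_le measurable_const measurable_norm
  have hstep : ∀ s : ℝ, μ.real {x | s ≤ ‖x‖} ≤ 1 / 36 →
      μ.real {x | 3 * s ≤ ‖x‖} ≤ μ.real {x | s ≤ ‖x‖} * (1 / 18) := by
    intro s hs
    have h1 := ENNReal.toReal_mono (by finiteness) (hlc.measure_norm_ge_three_mul s)
    have h2 : (μ (Metric.ball 0 s)).toReal = 1 - μ.real {x | s ≤ ‖x‖} := by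
      have : Metric.ball (0 : EuclideanSpace ℝ (Fin n)) s = {x | s ≤ ‖x‖}ᶜ := by
        ext x
        simp
      rw [this]
      exact probReal_compl_eq_one_sub (hmeas s)
    rw [ENNReal.toReal_mul, ENNReal.toReal_pow, h2] at h1
    change μ.real _ * _ ≤ μ.real _ ^ 2 at h1
    have h3 : 0 ≤ μ.real {x | s ≤ ‖x‖} := measureReal_nonneg
    have h4 : 0 ≤ μ.real {x | 3 * s ≤ ‖x‖} := measureReal_nonneg
    nlinarith
  have hbound : ∀ k : ℕ, μ.real {x | 3 ^ k * r ≤ ‖x‖} ≤ 1 / 36 * (1 / 18) ^ k := by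
    intro k
    induction k with
    | zero =>
      have := ENNReal.toReal_mono ENNReal.ofReal_ne_top hr36
      rw [ENNReal.toReal_ofReal (by norm_num)] at this
      simpa [Measure.real] using this
    | succ k ih =>
      have h1 : (1 / 18 : ℝ) ^ k ≤ 1 := pow_le_one₀ (by norm_num) (by norm_num)
      have h2 := hstep (3 ^ k * r) (ih.trans (by linarith))
      rw [← mul_assoc, ← pow_succ'] at h2
      rw [pow_succ (1 / 18 : ℝ)]
      linarith
  have hpt : ∀ x : EuclideanSpace ℝ (Fin n), ENNReal.ofReal (‖x‖ ^ 2) ≤ ENNReal.ofReal (r ^ 2) +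
      ∑' k : ℕ, {x : EuclideanSpace ℝ (Fin n) | 3 ^ k * r ≤ ‖x‖}.indicator
        (fun _ => ENNReal.ofReal ((3 ^ (k + 1) * r) ^ 2)) x := by
    intro x
    rcases lt_or_ge ‖x‖ r with h | h
    · exact le_add_right (ENNReal.ofReal_le_ofReal (by gcongr))
    · obtain ⟨k, hk1, hk2⟩ := exists_nat_pow_near ((one_le_div hr).2 h) (by norm_num : (1 : ℝ) < 3)
      rw [le_div_iff₀ hr] at hk1
      rw [div_lt_iff₀ hr] at hk2
      refine le_trans ?_ (le_add_left (ENNReal.le_tsum k))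
      rw [Set.indicator_of_mem (by exact hk1)]
      exact ENNReal.ofReal_le_ofReal (by gcongr)
  refine (lintegral_mono hpt).trans_lt ?_
  rw [lintegral_add_left measurable_const,
    lintegral_tsum fun k => (measurable_const.indicator (hmeas _)).aemeasurable]
  refine ENNReal.add_lt_top.2 ⟨by simp, ?_⟩
  have hle : ∀ k : ℕ, ∫⁻ x, {x : EuclideanSpace ℝ (Fin n) | 3 ^ k * r ≤ ‖x‖}.indicator
      (fun _ => ENNReal.ofReal ((3 ^ (k + 1) * r) ^ 2)) x ∂μ ≤
      ENNReal.ofReal (r ^ 2 / 4 * (1 / 2) ^ k) := by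
    intro k
    rw [lintegral_indicator_const (hmeas _), ← ofReal_measureReal,
      ← ENNReal.ofReal_mul (by positivity)]
    refine ENNReal.ofReal_le_ofReal ?_
    calc (3 ^ (k + 1) * r) ^ 2 * μ.real {x | 3 ^ k * r ≤ ‖x‖}
        ≤ (3 ^ (k + 1) * r) ^ 2 * (1 / 36 * (1 / 18) ^ k) := by gcongr; exact hbound k
      _ = r ^ 2 / 4 * ((3 ^ k) ^ 2 * (1 / 18) ^ k) := by ring
      _ = r ^ 2 / 4 * (1 / 2) ^ k := by
        rw [← pow_mul, mul_comm k 2, pow_mul, ← mul_pow]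
        norm_num
  refine (ENNReal.tsum_le_tsum hle).trans_lt ?_
  exact ((summable_geometric_two.mul_left _).tsum_ofReal_ne_top).lt_top

end Moments

/-! ### Smoothing by a small ball and the domination principle for measures -/

section Smoothing

variable {n : ℕ} {μ : Measure (EuclideanSpace ℝ (Fin n))}

/-- The uniform probability measure on the unit ball. -/
noncomputable def ballMeasure (n : ℕ) : Measure (EuclideanSpace ℝ (Fin n)) :=
  (volume (Metric.ball (0 : EuclideanSpace ℝ (Fin n)) 1))⁻¹ • volume.restrict (Metric.ball 0 1)

instance (n : ℕ) : IsProbabilityMeasure (ballMeasure n) := by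
  constructor
  rw [ballMeasure, Measure.smul_apply, Measure.restrict_apply_univ, smul_eq_mul]
  exact ENNReal.inv_mul_cancel (Metric.measure_ball_pos _ _ one_pos).ne' measure_ball_lt_top.ne

theorem lintegral_ballMeasure (g : EuclideanSpace ℝ (Fin n) → ℝ≥0∞) :
    ∫⁻ u, g u ∂(ballMeasure n) = (volume (Metric.ball (0 : EuclideanSpace ℝ (Fin n)) 1))⁻¹ *
      ∫⁻ u, (Metric.ball 0 1).indicator g u := by
  rw [ballMeasure, lintegral_smul_measure, lintegral_indicator Metric.isOpen_ball.measurableSet,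
    smul_eq_mul]

theorem isRotationallyInvariant_ballMeasure : IsRotationallyInvariant (ballMeasure n) := by
  intro U
  rw [ballMeasure, Measure.map_smul]
  congr 1
  have h := (U.measurePreserving.restrict_preimage
    (Metric.isOpen_ball (x := (0 : EuclideanSpace ℝ (Fin n))) (ε := 1)).measurableSet).map_eq
  have h2 : U ⁻¹' Metric.ball 0 1 = Metric.ball 0 1 := by
    ext x
    simp
  rwa [h2] at h

/-- The density of `l (X + ε U)`, where `X` has law `μ` and `U` is uniform on the unit ball and
independent of `X`. -/
noncomputable def smoothDensity (μ : Measure (EuclideanSpace ℝ (Fin n))) (l ε : ℝ)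
    (z : EuclideanSpace ℝ (Fin n)) : ℝ :=
  (((l * ε) ^ n)⁻¹ * (volume (Metric.ball (0 : EuclideanSpace ℝ (Fin n)) 1)).toReal⁻¹) *
    μ.real (Metric.ball (l⁻¹ • z) ε)

theorem measurable_smoothDensity [IsFiniteMeasure μ] (l ε : ℝ) :
    Measurable (smoothDensity μ l ε) := by
  have hs : MeasurableSet {q : EuclideanSpace ℝ (Fin n) × EuclideanSpace ℝ (Fin n) |
      dist q.2 (l⁻¹ • q.1) < ε} :=
    measurableSet_lt (by fun_prop) measurable_const
  exact ((measurable_measure_prodMk_left (ν := μ) hs).ennreal_toReal).const_mul _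

/-- Substitute `z = l(x + εu)` and apply Fubini on `{(x, z) : |x - z/l| < ε}`: slices in `z` give
the smoothed law, slices in `x` give balls. -/
theorem lintegral_mul_smoothDensity [IsProbabilityMeasure μ] {l ε : ℝ} (hl : 0 < l) (hε : 0 < ε)
    {g : EuclideanSpace ℝ (Fin n) → ℝ≥0∞} (hg : Measurable g) :
    ∫⁻ z, g z * ENNReal.ofReal (smoothDensity μ l ε z) =
      ∫⁻ x, ∫⁻ u, g (l • (x + ε • u)) ∂(ballMeasure n) ∂μ := by
  have hω := volume_unit_ball_toReal_pos n
  have hlε : 0 < l * ε := mul_pos hl hε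
  set T : Set (EuclideanSpace ℝ (Fin n) × EuclideanSpace ℝ (Fin n)) :=
    {q | dist q.1 (l⁻¹ • q.2) < ε} with hT
  have hTm : MeasurableSet T := measurableSet_lt (by fun_prop) measurable_const
  have hinner : ∀ x, ∫⁻ u, g (l • (x + ε • u)) ∂(ballMeasure n) =
      (volume (Metric.ball (0 : EuclideanSpace ℝ (Fin n)) 1))⁻¹ *
        (ENNReal.ofReal (((l * ε) ^ n)⁻¹) * ∫⁻ z, T.indicator (fun q => g q.2) (x, z)) := by
    intro x
    rw [lintegral_ballMeasure, ← lintegral_comp_smul (fun z => T.indicator (fun q => g q.2) (x, z))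
      hlε, ← lintegral_add_right_eq_self
      (fun u => T.indicator (fun q => g q.2) (x, (l * ε) • u)) (ε⁻¹ • x)]
    congr 1
    refine lintegral_congr fun u => ?_
    have h1 : (l * ε) • (u + ε⁻¹ • x) = l • (x + ε • u) := by
      rw [smul_add, smul_smul, mul_assoc, mul_inv_cancel₀ hε.ne', mul_one, smul_add, smul_smul,
        add_comm]
    have h2 : (x, l • (x + ε • u)) ∈ T ↔ u ∈ Metric.ball (0 : EuclideanSpace ℝ (Fin n)) 1 := by
      simp only [hT, Set.mem_ofPred_eq, smul_smul, inv_mul_cancel₀ hl.ne', one_smul,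
        mem_ball_zero_iff, dist_self_add_right, norm_smul, Real.norm_of_nonneg hε.le]
      exact mul_lt_iff_lt_one_right hε
    rw [h1]
    by_cases hu : u ∈ Metric.ball (0 : EuclideanSpace ℝ (Fin n)) 1
    · rw [Set.indicator_of_mem hu, Set.indicator_of_mem (h2.2 hu)]
    · rw [Set.indicator_of_notMem hu, Set.indicator_of_notMem fun h => hu (h2.1 h)]
  have hTg : Measurable (T.indicator fun q => g q.2) := (hg.comp measurable_snd).indicator hTm
  simp_rw [hinner]
  rw [lintegral_const_mul' _ _ (by simp [(Metric.measure_ball_pos volume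
      (0 : EuclideanSpace ℝ (Fin n)) one_pos).ne']),
    lintegral_const_mul' _ _ ENNReal.ofReal_ne_top,
    lintegral_lintegral_swap (f := fun x z => T.indicator (fun q => g q.2) (x, z))
      hTg.aemeasurable, ← mul_assoc, ← lintegral_const_mul]
  · refine lintegral_congr fun z => ?_
    have h1 : (fun x => T.indicator (fun q => g q.2) (x, z)) =
        (Metric.ball (l⁻¹ • z) ε).indicator fun _ => g z := by
      ext x
      simp [Set.indicator, hT]
    rw [h1, lintegral_indicator_const Metric.isOpen_ball.measurableSet, smoothDensity,
      ENNReal.ofReal_mul (by positivity), ENNReal.ofReal_mul (by positivity), ofReal_measureReal,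
      ENNReal.ofReal_inv_of_pos hω, ENNReal.ofReal_toReal measure_ball_lt_top.ne]
    ring
  · exact hTg.lintegral_prod_left'

theorem smoothDensity_nonneg {l ε : ℝ} (hl : 0 < l) (hε : 0 < ε) (z : EuclideanSpace ℝ (Fin n)) :
    0 ≤ smoothDensity μ l ε z := by
  unfold smoothDensity
  positivity

theorem smoothDensity_radial (hrot : IsRotationallyInvariant μ) {l ε : ℝ}
    {x y : EuclideanSpace ℝ (Fin n)} (h : ‖x‖ = ‖y‖) :
    smoothDensity μ l ε x = smoothDensity μ l ε y := by
  rw [smoothDensity, smoothDensity, Measure.real, Measure.real,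
    hrot.measure_ball_eq (x := l⁻¹ • x) (y := l⁻¹ • y) (by rw [norm_smul, norm_smul, h])]

/-- Minkowski combinations of balls of radius `ε` lie in the ball of radius `ε` about the combined
centre, so log-concavity of the measure becomes log-concavity of the density. -/
theorem smoothDensity_logConcave [IsProbabilityMeasure μ] (hlc : IsLogConcave μ) {l ε : ℝ}
    (hl : 0 < l) (hε : 0 < ε) (x y : EuclideanSpace ℝ (Fin n)) {t : ℝ} (ht0 : 0 < t)
    (ht1 : t < 1) :
    smoothDensity μ l ε x ^ (1 - t) * smoothDensity μ l ε y ^ t ≤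
      smoothDensity μ l ε ((1 - t) • x + t • y) := by
  have hω := volume_unit_ball_toReal_pos n
  unfold smoothDensity
  set C := ((l * ε) ^ n)⁻¹ * (volume (Metric.ball (0 : EuclideanSpace ℝ (Fin n)) 1)).toReal⁻¹
  have hC : 0 < C := by positivity
  have hsub : (1 - t) • Metric.ball (l⁻¹ • x) ε + t • Metric.ball (l⁻¹ • y) ε ⊆
      Metric.ball (l⁻¹ • ((1 - t) • x + t • y)) ε := by
    rintro _ ⟨_, ⟨p, hp, rfl⟩, _, ⟨q, hq, rfl⟩, rfl⟩
    rw [mem_ball_iff_norm] at hp hq ⊢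
    have h1 : (1 - t) • p + t • q - l⁻¹ • ((1 - t) • x + t • y) =
        (1 - t) • (p - l⁻¹ • x) + t • (q - l⁻¹ • y) := by
      module
    change ‖(1 - t) • p + t • q - l⁻¹ • ((1 - t) • x + t • y)‖ < ε
    rw [h1]
    refine (norm_add_le _ _).trans_lt ?_
    rw [norm_smul, norm_smul, Real.norm_of_nonneg (by linarith), Real.norm_of_nonneg ht0.le]
    nlinarith
  have h := (hlc _ _ Metric.isOpen_ball.measurableSet Metric.isOpen_ball.measurableSet t ht0
    ht1).trans (measure_mono hsub)
  have h' := ENNReal.toReal_mono (measure_ne_top _ _) h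
  rw [ENNReal.toReal_mul, ← ENNReal.toReal_rpow, ← ENNReal.toReal_rpow] at h'
  rw [Real.mul_rpow hC.le measureReal_nonneg, Real.mul_rpow hC.le measureReal_nonneg,
    mul_mul_mul_comm, ← Real.rpow_add hC, sub_add_cancel, Real.rpow_one]
  exact mul_le_mul_of_nonneg_left h' hC.le

/-- The cross term `2⟨x, v⟩` cancels on averaging with `-x`. Doubling the identity avoids
subtraction in `ℝ≥0∞`. -/
theorem lintegral_sq_norm_add [IsProbabilityMeasure μ] (hrot : IsRotationallyInvariant μ)
    (v : EuclideanSpace ℝ (Fin n)) :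
    ∫⁻ x, ENNReal.ofReal (‖x + v‖ ^ 2) ∂μ =
      ∫⁻ x, ENNReal.ofReal (‖x‖ ^ 2) ∂μ + ENNReal.ofReal (‖v‖ ^ 2) := by
  have h1 : ∫⁻ x, ENNReal.ofReal (‖-x + v‖ ^ 2) ∂μ = ∫⁻ x, ENNReal.ofReal (‖x + v‖ ^ 2) ∂μ :=
    hrot.lintegral_comp (LinearIsometryEquiv.neg ℝ) fun x => ENNReal.ofReal (‖x + v‖ ^ 2)
  have h2 : 2 * ∫⁻ x, ENNReal.ofReal (‖x + v‖ ^ 2) ∂μ =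
      2 * (∫⁻ x, ENNReal.ofReal (‖x‖ ^ 2) ∂μ + ENNReal.ofReal (‖v‖ ^ 2)) := by
    rw [two_mul]
    nth_rewrite 1 [← h1]
    rw [← lintegral_add_left (by fun_prop)]
    have h3 : ∀ x : EuclideanSpace ℝ (Fin n),
        ENNReal.ofReal (‖-x + v‖ ^ 2) + ENNReal.ofReal (‖x + v‖ ^ 2) =
        2 * (ENNReal.ofReal (‖x‖ ^ 2) + ENNReal.ofReal (‖v‖ ^ 2)) := by
      intro x
      rw [two_mul, ← ENNReal.ofReal_add (by positivity) (by positivity),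
        ← ENNReal.ofReal_add (by positivity) (by positivity),
        ← ENNReal.ofReal_add (by positivity) (by positivity), norm_add_sq_real, norm_add_sq_real, inner_neg_left,
        norm_neg]
      congr 1
      ring
    simp_rw [h3]
    rw [lintegral_const_mul' _ _ (by simp), lintegral_add_right _ measurable_const]
    simp
  exact (ENNReal.mul_right_inj (by simp) (by simp)).1 h2

/-- The second moment of the uniform measure on the unit ball. -/
noncomputable def ballMoment (n : ℕ) : ℝ := (∫⁻ u, ENNReal.ofReal (‖u‖ ^ 2) ∂(ballMeasure n)).toReal

theorem lintegral_sq_norm_ballMeasure :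
    ∫⁻ u, ENNReal.ofReal (‖u‖ ^ 2) ∂(ballMeasure n) = ENNReal.ofReal (ballMoment n) := by
  refine (ENNReal.ofReal_toReal (ne_top_of_le_ne_top ENNReal.one_ne_top ?_)).symm
  have hle : ∫⁻ u, ENNReal.ofReal (‖u‖ ^ 2) ∂(ballMeasure n) ≤ ∫⁻ _u, 1 ∂(ballMeasure n) := by
    rw [lintegral_ballMeasure, lintegral_ballMeasure]
    refine mul_le_mul_right (lintegral_mono fun u => ?_) _
    by_cases hu : u ∈ Metric.ball (0 : EuclideanSpace ℝ (Fin n)) 1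
    · rw [Set.indicator_of_mem hu, Set.indicator_of_mem hu, ← ENNReal.ofReal_one]
      rw [mem_ball_zero_iff] at hu
      exact ENNReal.ofReal_le_ofReal (pow_le_one₀ (norm_nonneg _) hu.le)
    · rw [Set.indicator_of_notMem hu, Set.indicator_of_notMem hu]
  simpa using hle

/-- A rotationally invariant log-concave probability measure is dominated, on nonnegative convex
functions of `|x|²`, by the radial exponential law with the same second moment. -/
theorem lintegral_convex_le_of_isLogConcave [IsProbabilityMeasure μ] (hn : 1 ≤ n)
    (hrot : IsRotationallyInvariant μ) (hlc : IsLogConcave μ) {a : ℝ} (ha : 0 < a)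
    (hpos : 0 < ∫⁻ x, ENNReal.ofReal (‖x‖ ^ 2) ∂μ)
    (hmom : ∫⁻ x, ENNReal.ofReal (‖x‖ ^ 2) ∂μ = ∫⁻ x, ENNReal.ofReal (‖x‖ ^ 2) ∂(expMeasure n a))
    {φ : ℝ → ℝ} (hφ : ConvexOn ℝ (Set.Ici 0) φ) (hφ0 : ∀ y, 0 ≤ y → 0 ≤ φ y)
    (hφc : Continuous fun x : EuclideanSpace ℝ (Fin n) => φ (‖x‖ ^ 2)) :
    ∫⁻ x, ENNReal.ofReal (φ (‖x‖ ^ 2)) ∂μ ≤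
      ∫⁻ x, ENNReal.ofReal (φ (‖x‖ ^ 2)) ∂(expMeasure n a) := by
  obtain ⟨m, hm, hmμ⟩ : ∃ m : ℝ, 0 < m ∧ ∫⁻ x, ENNReal.ofReal (‖x‖ ^ 2) ∂μ = ENNReal.ofReal m := by
    have hfin := hlc.lintegral_sq_norm_lt_top
    exact ⟨_, ENNReal.toReal_pos hpos.ne' hfin.ne, (ENNReal.ofReal_toReal hfin.ne).symm⟩
  have hκ : 0 ≤ ballMoment n := ENNReal.toReal_nonneg
  -- Adding `εU` raises the second moment from `m` to `m + ε² ballMoment n`; this dilation restores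
  -- `m`, so the same `a` serves for every `ε`.
  set Λ : ℝ → ℝ := fun ε => √(m / (m + ε ^ 2 * ballMoment n)) with hΛ
  have hΛ0 : ∀ ε, 0 < Λ ε := fun ε => by positivity
  have hΛc : Continuous Λ := by
    refine Real.continuous_sqrt.comp (continuous_const.div (by fun_prop) fun ε => ?_)
    positivity
  have hΛ1 : Λ 0 = 1 := by simp [hΛ, hm.ne']
  have hbound : ∀ ε, 0 < ε → ∫⁻ x, ∫⁻ u, ENNReal.ofReal (φ (‖Λ ε • (x + ε • u)‖ ^ 2))
      ∂(ballMeasure n) ∂μ ≤ ∫⁻ x, ENNReal.ofReal (φ (‖x‖ ^ 2)) ∂(expMeasure n a) := by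
    intro ε hε
    have hφm : Measurable fun x : EuclideanSpace ℝ (Fin n) => ENNReal.ofReal (φ (‖x‖ ^ 2)) :=
      hφc.measurable.ennreal_ofReal
    rw [← lintegral_mul_smoothDensity (hΛ0 ε) hε hφm]
    refine le_trans (le_of_eq (lintegral_congr fun z => ?_))
      (lintegral_convex_le_expMeasure ha hn (f := smoothDensity μ (Λ ε) ε)
      (smoothDensity_nonneg (hΛ0 ε) hε) (measurable_smoothDensity _ _)
      (fun x y h => smoothDensity_radial hrot h)
      (fun x y t h0 h1 => smoothDensity_logConcave hlc (hΛ0 ε) hε x y h0 h1) ?_ ?_ hφ hφ0 hφc)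
    · exact (ENNReal.ofReal_mul (hφ0 _ (sq_nonneg _))).symm
    · have h := lintegral_mul_smoothDensity (μ := μ) (hΛ0 ε) hε
        (g := fun _ => 1) measurable_const
      simpa using h
    · have h := lintegral_mul_smoothDensity (μ := μ) (hΛ0 ε) hε
        (g := fun x => ENNReal.ofReal (‖x‖ ^ 2)) (by fun_prop)
      simp_rw [← ENNReal.ofReal_mul (sq_nonneg (‖_‖ : ℝ))] at h
      rw [h, ← hmom, hmμ, lintegral_lintegral_swap (by fun_prop)]
      have h1 : ∀ u, ∫⁻ x, ENNReal.ofReal (‖Λ ε • (x + ε • u)‖ ^ 2) ∂μ =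
          ENNReal.ofReal (Λ ε ^ 2) *
            (ENNReal.ofReal m + ENNReal.ofReal (ε ^ 2) * ENNReal.ofReal (‖u‖ ^ 2)) := by
        intro u
        have h2 : ∀ x, ENNReal.ofReal (‖Λ ε • (x + ε • u)‖ ^ 2) =
            ENNReal.ofReal (Λ ε ^ 2) * ENNReal.ofReal (‖x + ε • u‖ ^ 2) := by
          intro x
          rw [norm_smul, mul_pow, Real.norm_eq_abs, sq_abs, ENNReal.ofReal_mul (sq_nonneg _)]
        simp_rw [h2]
        rw [lintegral_const_mul' _ _ ENNReal.ofReal_ne_top, lintegral_sq_norm_add hrot, hmμ,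
          norm_smul, mul_pow, Real.norm_eq_abs, sq_abs, ENNReal.ofReal_mul (sq_nonneg ε)]
      simp_rw [h1]
      rw [lintegral_const_mul' _ _ ENNReal.ofReal_ne_top, lintegral_add_left measurable_const,
        lintegral_const_mul' _ _ ENNReal.ofReal_ne_top, lintegral_sq_norm_ballMeasure,
        lintegral_const, measure_univ, mul_one, ← ENNReal.ofReal_mul (sq_nonneg _),
        ← ENNReal.ofReal_add hm.le (by positivity), ← ENNReal.ofReal_mul (sq_nonneg _)]
      congr 1
      rw [hΛ, Real.sq_sqrt (by positivity)]
      field_simp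
  set ε : ℕ → ℝ := fun k => 1 / ((k : ℝ) + 1) with hεdef
  have hε0 : ∀ k, 0 < ε k := fun k => by positivity
  have hεlim : Filter.Tendsto ε Filter.atTop (nhds 0) := tendsto_one_div_add_atTop_nhds_zero_nat
  set F : ℕ → EuclideanSpace ℝ (Fin n) × EuclideanSpace ℝ (Fin n) → ℝ≥0∞ := fun k q =>
    ENNReal.ofReal (φ (‖Λ (ε k) • (q.1 + ε k • q.2)‖ ^ 2)) with hF
  have hFm : ∀ k, Measurable (F k) := by
    intro k
    have h1 : Continuous fun q : EuclideanSpace ℝ (Fin n) × EuclideanSpace ℝ (Fin n) =>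
      Λ (ε k) • (q.1 + ε k • q.2) := by fun_prop
    exact (hφc.comp h1).measurable.ennreal_ofReal
  have hFlim : ∀ q, Filter.liminf (fun k => F k q) Filter.atTop =
      ENNReal.ofReal (φ (‖q.1‖ ^ 2)) := by
    intro q
    refine Filter.Tendsto.liminf_eq ?_
    have h1 : Continuous fun s : ℝ => ENNReal.ofReal (φ (‖Λ s • (q.1 + s • q.2)‖ ^ 2)) := by
      have h2 : Continuous fun s : ℝ => Λ s • (q.1 + s • q.2) := by fun_prop
      exact ENNReal.continuous_ofReal.comp (hφc.comp h2)
    have h3 : Filter.Tendsto (fun k => F k q) Filter.atTop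
        (nhds (ENNReal.ofReal (φ (‖Λ 0 • (q.1 + (0 : ℝ) • q.2)‖ ^ 2)))) :=
      (h1.tendsto 0).comp hεlim
    rwa [hΛ1, zero_smul, add_zero, one_smul] at h3
  calc ∫⁻ x, ENNReal.ofReal (φ (‖x‖ ^ 2)) ∂μ
      = ∫⁻ q, Filter.liminf (fun k => F k q) Filter.atTop ∂(μ.prod (ballMeasure n)) := by
        simp_rw [hFlim]
        have h : Measurable fun q : EuclideanSpace ℝ (Fin n) × EuclideanSpace ℝ (Fin n) =>
            ENNReal.ofReal (φ (‖q.1‖ ^ 2)) := (hφc.comp continuous_fst).measurable.ennreal_ofReal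
        rw [lintegral_prod _ h.aemeasurable]
        simp
    -- Fatou's lemma has the required direction, so no growth bound on `φ` is needed.
    _ ≤ Filter.liminf (fun k => ∫⁻ q, F k q ∂(μ.prod (ballMeasure n))) Filter.atTop :=
        lintegral_liminf_le hFm
    _ ≤ _ := by
        refine Filter.liminf_le_of_frequently_le' (Filter.Frequently.of_forall fun k => ?_)
        rw [lintegral_prod _ (hFm k).aemeasurable]
        exact hbound (ε k) (hε0 k)

end Smoothing

/-! ### Laplace transforms of rotationally invariant laws -/

section SphericalAverage

variable {n : ℕ} {μ : Measure (EuclideanSpace ℝ (Fin n))}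

/-- The power series of `cosh` has only even powers, so this is a power series in `y` with
nonnegative coefficients. -/
theorem convexOn_cosh_mul_sqrt (k : ℝ) : ConvexOn ℝ (Set.Ici 0) fun y => Real.cosh (k * √y) := by
  have hsum : ∀ y : ℝ, 0 ≤ y →
      HasSum (fun j : ℕ => (k ^ 2) ^ j / (2 * j).factorial * y ^ j) (Real.cosh (k * √y)) := by
    intro y hy
    have h := Real.hasSum_cosh (k * √y)
    convert h using 2 with j
    rw [pow_mul, mul_pow, Real.sq_sqrt hy, mul_pow]
    ring
  refine ⟨convex_Ici 0, fun y hy z hz a b ha hb hab => ?_⟩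
  have hy0 : 0 ≤ y := hy
  have hz0 : 0 ≤ z := hz
  refine hasSum_le (fun j => ?_) (hsum (a • y + b • z) (by simp only [smul_eq_mul]; positivity))
    (((hsum y hy0).const_smul a).add ((hsum z hz0).const_smul b))
  have h1 := (convexOn_pow j).2 hy hz ha hb hab
  have h2 : 0 ≤ (k ^ 2) ^ j / ((2 * j).factorial : ℝ) := by positivity
  have h3 := mul_le_mul_of_nonneg_left h1 h2
  simp only [smul_eq_mul] at h3 ⊢
  linarith

theorem abs_inner_div_norm_le_one {e : EuclideanSpace ℝ (Fin n)} (he : ‖e‖ = 1)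
    (u : EuclideanSpace ℝ (Fin n)) : |⟪e, u⟫ / ‖u‖| ≤ 1 := by
  have h := abs_real_inner_div_norm_mul_norm_le_one e u
  rwa [he, one_mul] at h

/-- The average of `e^{c ⟨x, θ⟩}` over unit vectors `θ`, as a function of `y = |x|²`; here `e` is a
unit vector. -/
noncomputable def sphericalCosh (e : EuclideanSpace ℝ (Fin n)) (c y : ℝ) : ℝ :=
  ∫ u, Real.cosh (c * (⟪e, u⟫ / ‖u‖) * √y) ∂(ballMeasure n)

theorem cosh_mul_le {c w r s : ℝ} (hw : |w| ≤ 1) (hr : |r| ≤ s) :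
    Real.cosh (c * w * r) ≤ Real.cosh (c * s) := by
  rw [Real.cosh_le_cosh, abs_mul, abs_mul, abs_mul, mul_assoc]
  have h1 : |w| * |r| ≤ |r| := mul_le_of_le_one_left (abs_nonneg r) hw
  exact mul_le_mul_of_nonneg_left (h1.trans (hr.trans (le_abs_self s))) (abs_nonneg c)

theorem integrable_sphericalCosh {e : EuclideanSpace ℝ (Fin n)} (he : ‖e‖ = 1) (c y : ℝ) :
    Integrable (fun u => Real.cosh (c * (⟪e, u⟫ / ‖u‖) * √y)) (ballMeasure n) := by
  refine Integrable.of_bound (C := Real.cosh (c * √y)) ?_ (Filter.Eventually.of_forall fun u => ?_)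
  · exact (by fun_prop : Measurable _).aestronglyMeasurable
  · rw [Real.norm_of_nonneg (Real.cosh_pos _).le]
    exact cosh_mul_le (abs_inner_div_norm_le_one he u) (abs_of_nonneg (Real.sqrt_nonneg y)).le

theorem sphericalCosh_nonneg (e : EuclideanSpace ℝ (Fin n)) (c y : ℝ) : 0 ≤ sphericalCosh e c y :=
  integral_nonneg fun _ => (Real.cosh_pos _).le

theorem convexOn_sphericalCosh {e : EuclideanSpace ℝ (Fin n)} (he : ‖e‖ = 1) (c : ℝ) :
    ConvexOn ℝ (Set.Ici 0) (sphericalCosh e c) := by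
  refine ⟨convex_Ici 0, fun y hy z hz a b ha hb hab => ?_⟩
  have iy := (integrable_sphericalCosh he c y).const_mul a
  have iz := (integrable_sphericalCosh he c z).const_mul b
  simp only [smul_eq_mul, sphericalCosh]
  rw [← integral_const_mul, ← integral_const_mul, ← integral_add iy iz]
  exact integral_mono (integrable_sphericalCosh he c _) (iy.add iz) fun u =>
    (convexOn_cosh_mul_sqrt _).2 hy hz ha hb hab

theorem continuous_sphericalCosh {e : EuclideanSpace ℝ (Fin n)} (he : ‖e‖ = 1) (c : ℝ) :
    Continuous (sphericalCosh e c) := by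
  refine continuous_iff_continuousAt.2 fun y => ?_
  refine continuousAt_of_dominated (bound := fun _ => Real.cosh (c * √(y + 1)))
    (Filter.Eventually.of_forall fun z => (integrable_sphericalCosh he c z).1) ?_
    (integrable_const _) (Filter.Eventually.of_forall fun u => ?_)
  · filter_upwards [eventually_le_nhds (lt_add_one y)] with z hz
    refine Filter.Eventually.of_forall fun u => ?_
    rw [Real.norm_of_nonneg (Real.cosh_pos _).le]
    refine cosh_mul_le (abs_inner_div_norm_le_one he u) ?_
    rw [abs_of_nonneg (Real.sqrt_nonneg z)]
    exact Real.sqrt_le_sqrt hz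
  · fun_prop

/-- Directions `u/|u|` of uniform points of the ball stand in for the sphere. An isometry taking
`|x| e` to `x` removes the direction of `x`, and the symmetry `u ↦ -u` turns `exp` into `cosh`. -/
theorem lintegral_exp_inner_ballMeasure {e : EuclideanSpace ℝ (Fin n)} (he : ‖e‖ = 1) (c : ℝ)
    (x : EuclideanSpace ℝ (Fin n)) :
    ∫⁻ u, ENNReal.ofReal (Real.exp ⟪x, (c / ‖u‖) • u⟫) ∂(ballMeasure n) =
      ENNReal.ofReal (sphericalCosh e c (‖x‖ ^ 2)) := by
  obtain ⟨U, hU⟩ := exists_linearIsometryEquiv_map_eq (x := ‖x‖ • e) (y := x)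
    (by rw [norm_smul, he, norm_norm, mul_one])
  set g : ℝ → EuclideanSpace ℝ (Fin n) → ℝ≥0∞ := fun s u =>
    ENNReal.ofReal (Real.exp (s * (c * (⟪e, u⟫ / ‖u‖) * ‖x‖))) with hg
  have h1 : ∫⁻ u, ENNReal.ofReal (Real.exp ⟪x, (c / ‖u‖) • u⟫) ∂(ballMeasure n) =
      ∫⁻ u, g 1 u ∂(ballMeasure n) := by
    rw [← isRotationallyInvariant_ballMeasure.lintegral_comp U]
    refine lintegral_congr fun u => ?_
    simp only [hg]
    congr 2
    nth_rewrite 1 [← hU]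
    rw [U.norm_map, inner_smul_right, U.inner_map_map, inner_smul_left]
    simp only [conj_trivial]
    ring
  have h2 : ∫⁻ u, g (-1) u ∂(ballMeasure n) = ∫⁻ u, g 1 u ∂(ballMeasure n) := by
    rw [← isRotationallyInvariant_ballMeasure.lintegral_comp (LinearIsometryEquiv.neg ℝ)]
    refine lintegral_congr fun u => ?_
    simp only [hg, LinearIsometryEquiv.coe_neg, inner_neg_right, norm_neg]
    congr 2
    ring
  have h3 : 2 * ∫⁻ u, g 1 u ∂(ballMeasure n) =
      2 * ENNReal.ofReal (sphericalCosh e c (‖x‖ ^ 2)) := by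
    rw [two_mul]
    nth_rewrite 2 [← h2]
    rw [← lintegral_add_left (by fun_prop), sphericalCosh,
      ofReal_integral_eq_lintegral_ofReal (integrable_sphericalCosh he c _)
        (Filter.Eventually.of_forall fun u => (Real.cosh_pos _).le),
      ← lintegral_const_mul' _ _ (by simp)]
    refine lintegral_congr fun u => ?_
    simp only [hg]
    rw [two_mul, ← ENNReal.ofReal_add (Real.exp_pos _).le (Real.exp_pos _).le,
      ← ENNReal.ofReal_add (Real.cosh_pos _).le (Real.cosh_pos _).le,
      Real.sqrt_sq (norm_nonneg x), Real.cosh_eq, one_mul, neg_one_mul]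
    congr 1
    ring
  rw [h1]
  exact (ENNReal.mul_right_inj (by simp) (by simp)).1 h3

theorem IsRotationallyInvariant.laplace_eq_of_norm_eq (hrot : IsRotationallyInvariant μ)
    {ξ η : EuclideanSpace ℝ (Fin n)} (h : ‖ξ‖ = ‖η‖) : laplace μ ξ = laplace μ η := by
  obtain ⟨U, rfl⟩ := exists_linearIsometryEquiv_map_eq h
  rw [laplace, laplace, ← hrot.lintegral_comp U fun x => ENNReal.ofReal (Real.exp ⟪x, U ξ⟫)]
  simp only [U.inner_map_map]

theorem ae_ne_zero_ballMeasure (hn : 1 ≤ n) : ∀ᵐ u ∂(ballMeasure n), u ≠ 0 := by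
  have h : (ballMeasure n) ≪ volume :=
    (Measure.smul_absolutelyContinuous).trans Measure.restrict_le_self.absolutelyContinuous
  filter_upwards [h.ae_le (ae_norm_ne hn 0)] with u hu
  simpa using hu

/-- The Laplace transform of a rotationally invariant measure as the integral of a convex function
of `|x|²`. -/
theorem IsRotationallyInvariant.laplace_eq [IsProbabilityMeasure μ] (hn : 1 ≤ n)
    (hrot : IsRotationallyInvariant μ) {e : EuclideanSpace ℝ (Fin n)} (he : ‖e‖ = 1)
    (ξ : EuclideanSpace ℝ (Fin n)) :
    laplace μ ξ = ∫⁻ x, ENNReal.ofReal (sphericalCosh e ‖ξ‖ (‖x‖ ^ 2)) ∂μ := by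
  -- The transform depends only on `|ξ|`, so it equals its average over all directions; exchanging
  -- the integrals then averages the exponential.
  have h1 : ∫⁻ u, laplace μ ((‖ξ‖ / ‖u‖) • u) ∂(ballMeasure n) = laplace μ ξ := by
    have h2 : ∫⁻ u, laplace μ ((‖ξ‖ / ‖u‖) • u) ∂(ballMeasure n) =
        ∫⁻ _u, laplace μ ξ ∂(ballMeasure n) := by
      refine lintegral_congr_ae ?_
      filter_upwards [ae_ne_zero_ballMeasure hn] with u hu
      refine hrot.laplace_eq_of_norm_eq ?_
      rw [norm_smul, Real.norm_of_nonneg (by positivity), div_mul_cancel₀ _ (norm_ne_zero_iff.2 hu)]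
    rw [h2]
    simp
  rw [← h1]
  unfold laplace
  rw [lintegral_lintegral_swap]
  · exact lintegral_congr fun x => lintegral_exp_inner_ballMeasure he _ x
  · exact (by fun_prop : Measurable _).aemeasurable

theorem isRotationallyInvariant_expMeasure (a : ℝ) : IsRotationallyInvariant (expMeasure n a) := by
  intro U
  refine Measure.ext_of_lintegral _ fun g hg => ?_
  rw [lintegral_map hg U.continuous.measurable, lintegral_expMeasure, lintegral_expMeasure,
    ← U.measurePreserving.lintegral_comp (f := fun x =>
      ENNReal.ofReal (expConst n a * Real.exp (-(a * ‖x‖))) * g x) (by fun_prop)]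
  simp

end SphericalAverage

/-! ### Matching second moments and the final comparison -/

section Main

variable {n : ℕ} {μ : Measure (EuclideanSpace ℝ (Fin n))}

theorem ae_eq_zero_of_lintegral_sq_norm_eq_zero (h : ∫⁻ x, ENNReal.ofReal (‖x‖ ^ 2) ∂μ = 0) :
    ∀ᵐ x ∂μ, x = 0 := by
  rw [lintegral_eq_zero_iff (by fun_prop)] at h
  filter_upwards [h] with x hx
  simpa using hx

theorem IsNondegenerate.lintegral_sq_norm_pos [IsProbabilityMeasure μ] (hn : 1 ≤ n)
    (hnd : IsNondegenerate μ) : 0 < ∫⁻ x, ENNReal.ofReal (‖x‖ ^ 2) ∂μ := by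
  refine pos_iff_ne_zero.2 fun h => ?_
  have hlt := hnd (EuclideanSpace.single ⟨0, hn⟩ 1) 0 (by simp)
  refine hlt.ne ?_
  rw [← mem_ae_iff_prob_eq_one (measurableSet_eq_fun (by fun_prop) measurable_const)]
  filter_upwards [ae_eq_zero_of_lintegral_sq_norm_eq_zero h] with x hx
  simp [hx]

/-- A zero second moment would concentrate the law at the origin and make its Laplace transform `1`,
but it is infinite at a unit vector. -/
theorem lintegral_sq_norm_expMeasure_one_pos (hn : 1 ≤ n) :
    0 < ∫⁻ x, ENNReal.ofReal (‖x‖ ^ 2) ∂(expMeasure n 1) := by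
  have hprob := isProbabilityMeasure_expMeasure (n := n) one_pos
  refine pos_iff_ne_zero.2 fun h => ?_
  have h1 : laplace (expMeasure n 1) (EuclideanSpace.single ⟨0, hn⟩ 1) = 1 := by
    have h2 : laplace (expMeasure n 1) (EuclideanSpace.single ⟨0, hn⟩ 1) =
        ∫⁻ _x, 1 ∂(expMeasure n 1) := by
      refine lintegral_congr_ae ?_
      filter_upwards [ae_eq_zero_of_lintegral_sq_norm_eq_zero h] with x hx
      simp [hx]
    rw [h2]
    simp
  rw [laplace_expMeasure_one_eq_top (by simp)] at h1
  exact ENNReal.top_ne_one h1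

/-- Scaling gives second moment `m₁ / a²`, where `m₁` is the value at `a = 1`; solve for `a`. -/
theorem exists_expMeasure_sq_norm_eq (hn : 1 ≤ n) {m : ℝ≥0∞} (hm0 : 0 < m) (hm : m < ⊤) :
    ∃ a : ℝ, 0 < a ∧ m = ∫⁻ x, ENNReal.ofReal (‖x‖ ^ 2) ∂(expMeasure n a) := by
  have hpos := lintegral_sq_norm_expMeasure_one_pos hn
  have hfin := lintegral_sq_norm_expMeasure_lt_top (n := n) one_pos
  set m₁ := ∫⁻ x, ENNReal.ofReal (‖x‖ ^ 2) ∂(expMeasure n 1) with hm₁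
  have h0 : 0 < m.toReal := ENNReal.toReal_pos hm0.ne' hm.ne
  have h1 : 0 < m₁.toReal := ENNReal.toReal_pos hpos.ne' hfin.ne
  have ha : 0 < √(m₁.toReal / m.toReal) := by positivity
  refine ⟨√(m₁.toReal / m.toReal), ha, ?_⟩
  rw [lintegral_expMeasure_scale ha]
  have h2 : ∀ x : EuclideanSpace ℝ (Fin n),
      ENNReal.ofReal (‖(√(m₁.toReal / m.toReal))⁻¹ • x‖ ^ 2) =
      ENNReal.ofReal (m.toReal / m₁.toReal) * ENNReal.ofReal (‖x‖ ^ 2) := by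
    intro x
    rw [norm_smul, mul_pow, Real.norm_eq_abs, sq_abs, inv_pow, Real.sq_sqrt (by positivity),
      inv_div, ENNReal.ofReal_mul (by positivity)]
  simp_rw [h2]
  rw [lintegral_const_mul' _ _ ENNReal.ofReal_ne_top, ← hm₁, ← ENNReal.ofReal_toReal hfin.ne,
    ← ENNReal.ofReal_mul (by positivity), ENNReal.toReal_ofReal h1.le,
    div_mul_cancel₀ _ h1.ne', ENNReal.ofReal_toReal hm.ne]

theorem exp_neg_cramer_expMeasure {a : ℝ} (ha : 0 < a) (x : EuclideanSpace ℝ (Fin n)) :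
    EReal.exp (-cramer (expMeasure n a) x) =
      ENNReal.ofReal (cramerProfile ((n : ℝ) + 1) (a ^ 2 * ‖x‖ ^ 2)) := by
  rw [exp_neg_cramer_expMeasure_scale ha, exp_neg_cramer_expMeasure_one, norm_smul, mul_pow,
    Real.norm_eq_abs, sq_abs]

end Main

theorem theorem3 {n : ℕ} (hn : 1 ≤ n) {Ω : Type*} [MeasurableSpace Ω]
    (P : Measure Ω) [IsProbabilityMeasure P]
    (X : Ω → EuclideanSpace ℝ (Fin n)) (hX : AEMeasurable X P)
    (hrot : IsRotationallyInvariant (P.map X))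
    (hlc : IsLogConcave (P.map X))
    (hnd : IsNondegenerate (P.map X)) :
    ∫⁻ ω, EReal.exp (-cramer (P.map X) (X ω)) ∂P ≤
      ∫⁻ x, EReal.exp (-cramer (radialExp n) x) ∂(radialExp n) := by
  have hprob : IsProbabilityMeasure (P.map X) := Measure.isProbabilityMeasure_map hX
  have hpos := hnd.lintegral_sq_norm_pos hn
  obtain ⟨a, ha, hmom⟩ := exists_expMeasure_sq_norm_eq hn hpos hlc.lintegral_sq_norm_lt_top
  have hprob' := isProbabilityMeasure_expMeasure (n := n) ha
  have hN : (0 : ℝ) < (n : ℝ) + 1 := by positivity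
  have he : ‖(EuclideanSpace.single ⟨0, hn⟩ 1 : EuclideanSpace ℝ (Fin n))‖ = 1 := by simp
  -- First use of the domination principle; the second, in the final chain, is for the convex
  -- profile of `e^{-Λ*}`.
  have hlap : ∀ ξ, laplace (P.map X) ξ ≤ laplace (expMeasure n a) ξ := by
    intro ξ
    rw [hrot.laplace_eq hn he, (isRotationallyInvariant_expMeasure a).laplace_eq hn he]
    exact lintegral_convex_le_of_isLogConcave hn hrot hlc ha hpos hmom
      (convexOn_sphericalCosh he _) (fun y _ => sphericalCosh_nonneg _ _ y)
      ((continuous_sphericalCosh he _).comp (continuous_norm.pow 2))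
  have hconv : ConvexOn ℝ (Set.Ici 0) fun y => cramerProfile ((n : ℝ) + 1) (a ^ 2 * y) := by
    refine ⟨convex_Ici 0, fun y hy z hz s t hs ht hst => ?_⟩
    have h := (convexOn_cramerProfile hN).2 (x := a ^ 2 * y) (y := a ^ 2 * z)
      (Set.mem_Ici.2 (mul_nonneg (sq_nonneg a) hy)) (Set.mem_Ici.2 (mul_nonneg (sq_nonneg a) hz))
      hs ht hst
    convert h using 2
    simp only [smul_eq_mul]
    ring
  have hcont : Continuous fun x : EuclideanSpace ℝ (Fin n) =>
      cramerProfile ((n : ℝ) + 1) (a ^ 2 * ‖x‖ ^ 2) :=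
    (continuous_cramerProfile hN).comp (continuous_const.mul (continuous_norm.pow 2))
  calc ∫⁻ ω, EReal.exp (-cramer (P.map X) (X ω)) ∂P
      ≤ ∫⁻ ω, ENNReal.ofReal (cramerProfile ((n : ℝ) + 1) (a ^ 2 * ‖X ω‖ ^ 2)) ∂P := by
        refine lintegral_mono fun ω => ?_
        rw [← exp_neg_cramer_expMeasure ha]
        exact exp_neg_cramer_mono hlap _
    _ = ∫⁻ x, ENNReal.ofReal (cramerProfile ((n : ℝ) + 1) (a ^ 2 * ‖x‖ ^ 2)) ∂(P.map X) :=
        (lintegral_map' hcont.measurable.ennreal_ofReal.aemeasurable hX).symm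
    _ ≤ ∫⁻ x, ENNReal.ofReal (cramerProfile ((n : ℝ) + 1) (a ^ 2 * ‖x‖ ^ 2)) ∂(expMeasure n a) :=
        lintegral_convex_le_of_isLogConcave hn hrot hlc ha hpos hmom hconv
          (fun _ _ => cramerProfile_nonneg) hcont
    _ = ∫⁻ x, EReal.exp (-cramer (expMeasure n a) x) ∂(expMeasure n a) := by
        simp_rw [exp_neg_cramer_expMeasure ha]
    -- The integral is invariant under dilation of the law, so the rate `a` may be replaced by the
    -- isotropic rate `√(n+1)`.
    _ = ∫⁻ x, EReal.exp (-cramer (radialExp n) x) ∂(radialExp n) := by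
        rw [radialExp_eq_expMeasure hn, lintegral_exp_neg_cramer_expMeasure ha,
          lintegral_exp_neg_cramer_expMeasure (a := √((n : ℝ) + 1)) (by positivity)]
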